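/- For $n\ge 0$ let $\mathrm{Av}^\star_{3n}(132)$ be the set of permutations $\pi=\pi_1\cdots\pi_{3n}$ of $[3n]=\{1,\dots,3n\}$ whose cycle decomposition consists only of $3$-cycles (so there are no fixed points) and that avoid the pattern $132$, i.e. there are no $i<j<k$ with $\pi_i<\pi_k<\pi_j$. Let $\mathcal{A}_{3n}\subseteq \mathrm{Av}^\star_{3n}(132)$ be the subset of those $\pi$ all of whose cycles are of the form $312$, meaning that if $\{p<q<r\}$ is the underlying set of a cycle of $\pi$, then $\pi_p=r$, $\pi_q=p$ and $\pi_r=q$. Put $a_m=|\mathcal{A}_{3m}|$. Then for all $n\ge 1$, \[ |\mathrm{Av}^\star_{3n}(132)| = 2\sum_{(x_1,\dots,x_k)} a_{x_1}a_{x_2}\cdots a_{x_k}, \] where the sum runs over all compositions $(x_1,\dots,x_k)$ of $n$ into positive integers, of every length $k\ge 1$. Furthermore, the generating function $B(x)=\sum_{n\ge 1}|\mathrm{Av}^\star_{3n}(132)|\,x^n$ is, as a formal power series, \[ B(x)=\frac{2A(x)}{1-A(x)},\qquad A(x)=(c(x)-1)\,m(c(x)-1), \] where $c(x)=\sum_{n\ge0}C_nx^n$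 is the generating function of the Catalan numbers $C_n$, and $m(x)=\sum_{n\ge 0}M_nx^n$ is the generating function of the Motzkin numbers: $M_n$ is the number of paths from $(0,0)$ to $(n,0)$ with steps $(1,1)$, $(1,0)$, $(1,-1)$ that never go below the $x$-axis. -/

import Mathlib

namespace ThreeCyclePerm

open Equiv

/-- The pattern `132` in one-line notation, on the letters `0, 1, 2` instead of `1, 2, 3`. -/
def pattern132 : Perm (Fin 3) := ⟨![0, 2, 1], ![0, 2, 1], by decide, by decide⟩

/-- The pattern `312` in one-line notation, on the letters `0, 1, 2` instead of `1, 2, 3`. -/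
def pattern312 : Perm (Fin 3) := ⟨![2, 0, 1], ![1, 2, 0], by decide, by decide⟩

/-- The values of `π` at the positions `f 0 < f 1 < ⋯ < f (k - 1)` are in the same relative order
as `σ`. -/
def IsOccurrence {n k : ℕ} (π : Perm (Fin n)) (σ : Perm (Fin k)) (f : Fin k ↪o Fin n) : Prop :=
  ∀ i j : Fin k, π (f i) < π (f j) ↔ σ i < σ j

/-- `π` avoids the pattern `σ`. -/
def Avoids {n k : ℕ} (π : Perm (Fin n)) (σ : Perm (Fin k)) : Prop :=
  ¬ ∃ f : Fin k ↪o Fin n, IsOccurrence π σ f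

/-- The permutations of `3n` letters that are composed of `n` disjoint `3`-cycles (and hence have
no fixed points). -/
def threeCyclePerms (n : ℕ) : Set (Perm (Fin (3 * n))) :=
  {π | π.cycleType = Multiset.replicate n 3}

/-- The permutations of `3n` letters that are composed only of `3`-cycles and avoid `σ`. -/
def avStar {k : ℕ} (n : ℕ) (σ : Perm (Fin k)) : Set (Perm (Fin (3 * n))) :=
  {π | π ∈ threeCyclePerms n ∧ Avoids π σ}

/-- The cycle `c` is of the form `σ`: its elements, listed as positions in increasing order, carry
values in the relative order of `σ`. -/
def CycleHasForm {n k : ℕ} (c : Perm (Fin n)) (σ : Perm (Fin k)) : Prop :=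
  ∃ f : Fin k ↪o Fin n, Set.range f = {i | i ∈ c.support} ∧ IsOccurrence c σ f

/-- The `132`-avoiding permutations of `3n` letters all of whose cycles are `3`-cycles of the form
`312`. -/
def setA (n : ℕ) : Set (Perm (Fin (3 * n))) :=
  {π | π ∈ avStar n pattern132 ∧ ∀ c ∈ π.cycleFactorsFinset, CycleHasForm c pattern312}

/-- The Motzkin paths of length `n`: sequences of `n` steps, up (`1`), flat (`0`) or down (`-1`),
from height `0` to height `0` that never go below height `0`. -/
def motzkinPaths (n : ℕ) : Set (Fin n → SignType) :=
  {s | (∀ k : ℕ, 0 ≤ ∑ i : Fin n with i.val < k, (s i : ℤ)) ∧ ∑ i : Fin n, (s i : ℤ) = 0}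

/-- The `n`-th Motzkin number. -/
noncomputable def motzkin (n : ℕ) : ℕ := (motzkinPaths n).ncard

/-- The generating function of the Catalan numbers. -/
noncomputable def catalanGF : PowerSeries ℚ := PowerSeries.mk fun n => (catalan n : ℚ)

/-- The generating function of the Motzkin numbers. -/
noncomputable def motzkinGF : PowerSeries ℚ := PowerSeries.mk fun n => (motzkin n : ℚ)

/-- The series `(c(x) - 1) m(c(x) - 1)`. The substitution is the genuine one, since `c(x) - 1` has
zero constant term. -/
noncomputable def seriesA : PowerSeries ℚ :=
  (catalanGF - 1) * PowerSeries.subst (catalanGF - 1) motzkinGF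

/-- The generating function of the number of `132`-avoiding permutations composed of `n`
`3`-cycles, over `n ≥ 1`. -/
noncomputable def seriesB : PowerSeries ℚ :=
  PowerSeries.mk fun n => if n = 0 then 0 else ((avStar n pattern132).ncard : ℚ)

end ThreeCyclePerm

namespace ThreeCyclePerm

open Equiv

/-! The smallest elements of the `n` cycles occupy the first `n` positions (`isMin_iff_lt`). Every
3-cycle is of the form 312 or 231; inversion exchanges the two forms and preserves avoidance of 132.
If a 312 cycle starts before a 231 cycle, then it encloses it: both of its larger elements lie above
the whole later cycle (`apply_apply_lt_of_312_231`). So if the first `x` cycles are 312 and the next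
one is 231, all later cycles together fill an interval, and the permutation is glued in a unique way
from an element of `setA x` and a smaller permutation that starts with a 231 cycle or is empty
(`run_add_eq_image`). Inversion carries `run n 0` to the union of the `run n x` with `1 ≤ x`, which
gives `r_n = ∑ a_x r_{n-x}` for `r_n = (run n 0).ncard`: this is the sum over compositions. The
factor 2 accounts for the two possible forms of the first cycle.

In an element of `setA n`, list the middle elements `q_k` and the largest elements `r_k` of the
cycles increasingly. Then `π r_k = q_k`, so `π` is determined by the interleaving of the two lists,
which is a ballot sequence `α`, and by the permutation `τ` that sends `k` to the smallest element of
the cycle of `q_k`. Avoidance of 132 means that `τ` avoids 132 and that each non-inversion of `τ`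
spans only steps `j` at which `α` stays constant and whose value `j + 1` it never takes
(`no132_build_iff`). One bit for jumps and one for values turn `α` into a path with up, down and two
kinds of flat steps (`sum_ballot`).

Split `τ` at its maximum. The `i` letters before it contribute the Catalan number `C_i` and force
the first `i` steps to carry two unset bits; the next step is free. For paths starting at height `h`
this gives `F_h = c ([h = 0] + x (F_{h-1} + 2 F_h + F_{h+1}))`. With `u = c - 1 = x c²`, the series
`D_h = x F_h` satisfy `D_h = u ([h = 0] + D_{h-1} + D_h + D_{h+1})`, the first-step recursion of
Motzkin paths with `u` for each step and one extra factor `u`. Its solution is unique since `u` has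
zero constant term, whence `A = x F_0` (`seriesA_eq`). -/

/-! ### Elementary forms of the defining conditions -/

/-- Elementary form of avoidance of `132`. -/
def No132 {n : ℕ} (π : Perm (Fin n)) : Prop :=
  ∀ i j k, i < j → j < k → π i < π k → π k < π j → False

/-- `π` is a product of `3`-cycles without fixed points. -/
def IsThree {n : ℕ} (π : Perm (Fin n)) : Prop :=
  ∀ i, π i ≠ i ∧ π (π (π i)) = i

/-- No cycle of `π` is of the form `231`. -/
def No231Cycle {n : ℕ} (π : Perm (Fin n)) : Prop :=
  ∀ i, i < π i → π i < π (π i) → False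

/-- The order embedding of `Fin 3` given by an increasing triple. -/
def tripleEmb {n : ℕ} (a b c : Fin n) (hab : a < b) (hbc : b < c) : Fin 3 ↪o Fin n :=
  OrderEmbedding.ofStrictMono ![a, b, c] (by
    intro i j hij
    fin_cases i <;> fin_cases j <;> simp_all
    exact hab.trans hbc)

@[simp]
theorem tripleEmb_zero {n : ℕ} (a b c : Fin n) (hab : a < b) (hbc : b < c) :
    tripleEmb a b c hab hbc 0 = a := rfl

@[simp]
theorem tripleEmb_one {n : ℕ} (a b c : Fin n) (hab : a < b) (hbc : b < c) :
    tripleEmb a b c hab hbc 1 = b := rfl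

@[simp]
theorem tripleEmb_two {n : ℕ} (a b c : Fin n) (hab : a < b) (hbc : b < c) :
    tripleEmb a b c hab hbc 2 = c := rfl

theorem avoids_pattern132_iff {n : ℕ} (π : Perm (Fin n)) :
    Avoids π pattern132 ↔ No132 π := by
  constructor
  · intro h i j k hij hjk h1 h2
    refine h ⟨tripleEmb i j k hij hjk, ?_⟩
    intro a b
    fin_cases a <;> fin_cases b <;>
      simp [pattern132, h1, h2, h1.trans h2, h1.le, h2.le, (h1.trans h2).le]
  · rintro h ⟨f, hf⟩
    refine h (f 0) (f 1) (f 2) (f.strictMono (by decide)) (f.strictMono (by decide)) ?_ ?_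
    · exact (hf 0 2).2 (by decide)
    · exact (hf 2 1).2 (by decide)

/-- As 3 is prime, `π ^ 3 = 1` leaves 3 as the only cycle length; full support then fixes the number
of cycles. -/
theorem mem_threeCyclePerms_iff {n : ℕ} (π : Perm (Fin (3 * n))) :
    π ∈ threeCyclePerms n ↔ IsThree π := by
  have : Fact (Nat.Prime 3) := ⟨Nat.prime_three⟩
  have hp : π ^ 3 = 1 ↔ ∀ i, π (π (π i)) = i := by
    rw [Equiv.ext_iff]
    simp [pow_succ]
  constructor
  · intro h
    have h : π.cycleType = Multiset.replicate n 3 := h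
    have h3 : π ^ 3 = 1 := by
      rw [Perm.pow_prime_eq_one_iff, h]
      intro c hc
      exact Multiset.eq_of_mem_replicate hc
    have hs : π.support.card = Fintype.card (Fin (3 * n)) := by
      rw [← Perm.sum_cycleType, h]
      simp [mul_comm]
    have hs : π.support = Finset.univ := Finset.card_eq_iff_eq_univ _ |>.1 hs
    intro i
    refine ⟨?_, hp.1 h3 i⟩
    have : i ∈ π.support := by rw [hs]; simp
    exact Perm.mem_support.1 this
  · intro h
    have h3 : π ^ 3 = 1 := hp.2 fun i => (h i).2
    have hs : π.support = Finset.univ := by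
      ext i
      simp [(h i).1]
    have hr : π.cycleType = Multiset.replicate (Multiset.card π.cycleType) 3 :=
      Multiset.eq_replicate_card.2 (Perm.pow_prime_eq_one_iff.1 h3)
    have hc := Perm.sum_cycleType π
    rw [hs, hr] at hc
    simp at hc
    have : Multiset.card π.cycleType = n := by omega
    rw [this] at hr
    exact hr

theorem mem_avStar_iff {n : ℕ} (π : Perm (Fin (3 * n))) :
    π ∈ avStar n pattern132 ↔ IsThree π ∧ No132 π := by
  rw [← mem_threeCyclePerms_iff, ← avoids_pattern132_iff]
  rfl

theorem IsThree.mem_support_cycleOf {n : ℕ} {π : Perm (Fin n)} (h : IsThree π) (i j : Fin n) :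
    j ∈ (π.cycleOf i).support ↔ j = i ∨ j = π i ∨ j = π (π i) := by
  rw [Perm.mem_support_cycleOf_iff' (h i).1]
  constructor
  · intro hs
    obtain ⟨k, hk⟩ := hs.exists_nat_pow_eq
    clear hs
    induction k generalizing j with
    | zero => exact Or.inl hk.symm
    | succ k ih =>
      rw [pow_succ', Perm.mul_apply] at hk
      rcases ih _ rfl with h1 | h1 | h1 <;> rw [h1] at hk
      · exact Or.inr (Or.inl hk.symm)
      · exact Or.inr (Or.inr hk.symm)
      · exact Or.inl (hk.symm.trans (h i).2)
  · rintro (rfl | rfl | rfl)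
    · exact Perm.SameCycle.refl _ _
    · exact Perm.sameCycle_apply_right.2 (Perm.SameCycle.refl _ _)
    · exact Perm.sameCycle_apply_right.2 (Perm.sameCycle_apply_right.2 (Perm.SameCycle.refl _ _))

/-- Read from its smallest element, a 3-cycle visits its other two elements either in increasing
order (231) or in decreasing order (312). -/
theorem IsThree.forall_cycleHasForm_iff {n : ℕ} {π : Perm (Fin n)} (h : IsThree π) :
    (∀ c ∈ π.cycleFactorsFinset, CycleHasForm c pattern312) ↔ No231Cycle π := by
  constructor
  · intro hc i h1 h2
    obtain ⟨f, hf, ho⟩ := hc (π.cycleOf i) (Perm.cycleOf_mem_cycleFactorsFinset_iff.2 (by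
      simpa using (h i).1))
    have hmem : ∀ j, (j = i ∨ j = π i ∨ j = π (π i)) → ∃ a, f a = j := by
      intro j hj
      have : j ∈ Set.range f := by
        rw [hf]
        exact (h.mem_support_cycleOf i j).2 hj
      exact this
    obtain ⟨a, ha⟩ := hmem _ (Or.inl rfl)
    obtain ⟨b, hb⟩ := hmem _ (Or.inr (Or.inl rfl))
    obtain ⟨c, hc⟩ := hmem _ (Or.inr (Or.inr rfl))
    have hab : a < b := f.lt_iff_lt.1 (by rw [ha, hb]; exact h1)
    have hbc : b < c := f.lt_iff_lt.1 (by rw [hb, hc]; exact h2)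
    have ha0 : a = 0 := by omega
    have hb1 : b = 1 := by omega
    subst ha0 hb1
    have := (ho 0 1).1 (by
      rw [ha, hb, Perm.cycleOf_apply_self,
        (Perm.sameCycle_apply_right.2 (Perm.SameCycle.refl _ _)).cycleOf_apply]
      exact h2)
    exact absurd this (by decide)
  · intro hN c hc
    rw [Perm.mem_cycleFactorsFinset_iff] at hc
    obtain ⟨x, hx⟩ : ∃ x, x ∈ c.support := by
      obtain ⟨x, hx, -⟩ := hc.1
      exact ⟨x, Perm.mem_support.2 hx⟩
    have hcx : c = π.cycleOf x := by
      rw [← Perm.cycle_is_cycleOf hx (Perm.mem_cycleFactorsFinset_iff.2 hc)]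
    obtain ⟨p, hp, hp1, hp2⟩ : ∃ p, c = π.cycleOf p ∧ p < π p ∧ p < π (π p) := by
      have h0 := h x
      have h1 := h (π x)
      have h2 := h (π (π x))
      have e1 : π.cycleOf (π x) = π.cycleOf x := by
        rw [Perm.SameCycle.cycleOf_eq (Perm.sameCycle_apply_left.2 (Perm.SameCycle.refl _ _))]
      have e2 : π.cycleOf (π (π x)) = π.cycleOf x := by
        rw [Perm.SameCycle.cycleOf_eq (Perm.sameCycle_apply_left.2 (Perm.sameCycle_apply_left.2
          (Perm.SameCycle.refl _ _)))]
      by_cases c1 : x < π x ∧ x < π (π x)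
      · exact ⟨x, hcx, c1⟩
      by_cases c2 : π x < x ∧ π x < π (π x)
      · exact ⟨π x, hcx.trans e1.symm, by rw [h0.2]; exact ⟨c2.2, c2.1⟩⟩
      · refine ⟨π (π x), hcx.trans e2.symm, ?_⟩
        rw [h1.2, h0.2]
        have h3 : π (π x) ≠ x := fun e => by
          have := h0.2
          rw [e] at this
          exact h0.1 this
        constructor <;> omega
    have hlt : π (π p) < π p := by
      rcases lt_trichotomy (π p) (π (π p)) with h1 | h1 | h1
      · exact (hN p hp1 h1).elim
      · exact ((h (π p)).1 h1.symm).elim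
      · exact h1
    have hs : ∀ j, (j = p ∨ j = π p ∨ j = π (π p)) → c j = π j := by
      intro j hj
      exact hc.2 j (by rw [hp]; exact (h.mem_support_cycleOf p j).2 hj)
    have s0 := hs p (by simp)
    have s1 := hs (π p) (by simp)
    have s2 := hs (π (π p)) (by simp)
    rw [(h p).2] at s2
    refine ⟨tripleEmb p (π (π p)) (π p) hp2 hlt, ?_, ?_⟩
    · ext j
      rw [Set.mem_ofPred_eq, hp, h.mem_support_cycleOf p j]
      simp only [Set.mem_range, Fin.exists_fin_succ]
      simp [eq_comm, or_comm]
    · intro a b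
      fin_cases a <;> fin_cases b <;>
        simp [pattern312, s0, s1, s2, hlt, hlt.le, hp1, hp2, hp1.le, hp2.le]

theorem mem_setA_iff {n : ℕ} (π : Perm (Fin (3 * n))) :
    π ∈ setA n ↔ IsThree π ∧ No132 π ∧ No231Cycle π := by
  constructor
  · rintro ⟨h1, h2⟩
    rw [mem_avStar_iff] at h1
    exact ⟨h1.1, h1.2, h1.1.forall_cycleHasForm_iff.1 h2⟩
  · rintro ⟨h1, h2, h3⟩
    exact ⟨(mem_avStar_iff π).2 ⟨h1, h2⟩, h1.forall_cycleHasForm_iff.2 h3⟩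

/-! ### Smallest elements of the cycles -/

theorem IsThree.apply_apply_ne {n : ℕ} {π : Perm (Fin n)} (h : IsThree π) (i : Fin n) :
    π (π i) ≠ i := fun e => (h i).1 (by
  have := (h i).2
  rwa [e] at this)

/-- `i` is the smallest element of its cycle. -/
def IsMin {n : ℕ} (π : Perm (Fin n)) (i : Fin n) : Prop :=
  i < π i ∧ i < π (π i)

instance {n : ℕ} (π : Perm (Fin n)) : DecidablePred (IsMin π) := fun _ => instDecidableAnd

/-- With such an `a` in the role of the letter 1, `π` must increase on the positions from `i` on
whose values are at least `i`. Applied around the cycle, `i < π i` yields `π i < π (π i)` and then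
`π (π i) < i`. -/
theorem IsMin.not_lt_of_apply_lt {n : ℕ} {π : Perm (Fin n)} (h : IsThree π) (hπ : No132 π)
    {a i : Fin n} (hi : IsMin π i) (ha : a < i) (ha' : π a < i) : False := by
  have key : ∀ x y, i ≤ x → x < y → i ≤ π y → π x < π y := by
    intro x y hx hxy hy
    by_contra hc
    exact hπ a x y (by omega) hxy (by omega)
      (lt_of_le_of_ne (not_lt.1 hc) fun e => hxy.ne' (π.injective e))
  obtain ⟨h1, h2⟩ := hi
  have h3 := key _ _ le_rfl h1 h2.le
  have h4 := key _ _ h1.le h3 (by rw [(h i).2])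
  rw [(h i).2] at h4
  omega

theorem IsMin.lt_of_not_isMin {n : ℕ} {π : Perm (Fin n)} (h : IsThree π) (hπ : No132 π)
    {i j : Fin n} (hi : IsMin π i) (hj : ¬ IsMin π j) : i < j := by
  by_contra hc
  have hij : j ≠ i := fun e => hj (e ▸ hi)
  have hji : j < i := by omega
  by_cases h1 : π j < j
  · exact hi.not_lt_of_apply_lt h hπ hji (by omega)
  · have := (h j).1
    have h2 := h.apply_apply_ne j
    have h3 : π (π j) < j := by
      by_contra h4
      exact hj ⟨by omega, by omega⟩
    exact hi.not_lt_of_apply_lt h hπ (a := π (π j)) (by omega) (by rw [(h j).2]; exact hji)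

/-- Among `i`, `π i`, `π (π i)` exactly one is smallest; summed over all `i`, every smallest element
is counted three times. -/
theorem IsThree.card_isMin {n : ℕ} {π : Perm (Fin (3 * n))} (h : IsThree π) :
    (Finset.univ.filter (IsMin π)).card = n := by
  have h1 : ∀ i, (if IsMin π i then 1 else 0) + (if IsMin π (π i) then 1 else 0)
      + (if IsMin π (π (π i)) then 1 else 0) = 1 := by
    intro i
    have h0 := h i
    have h1 := (h (π i)).1
    have h2 := h.apply_apply_ne i
    have e1 : IsMin π (π i) ↔ π i < π (π i) ∧ π i < i := by unfold IsMin; rw [h0.2]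
    have e2 : IsMin π (π (π i)) ↔ π (π i) < i ∧ π (π i) < π i := by
      unfold IsMin
      rw [h0.2]
    have e0 : IsMin π i ↔ i < π i ∧ i < π (π i) := Iff.rfl
    simp only [e0, e1, e2]
    split_ifs <;> omega
  have h2 : ∑ i, ((if IsMin π i then 1 else 0) + (if IsMin π (π i) then 1 else 0)
      + (if IsMin π (π (π i)) then 1 else 0)) = 3 * n := by
    simp [h1]
  rw [Finset.sum_add_distrib, Finset.sum_add_distrib,
    Equiv.sum_comp π (fun i => if IsMin π i then 1 else 0),
    Equiv.sum_comp π (fun i => if IsMin π (π i) then 1 else 0),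
    Equiv.sum_comp π (fun i => if IsMin π i then 1 else 0)] at h2
  rw [Finset.card_filter]
  omega

/-- There are `n` smallest elements and they precede all other positions, so they form the initial
segment of length `n`. -/
theorem isMin_iff_lt {n : ℕ} {π : Perm (Fin (3 * n))} (h : IsThree π) (hπ : No132 π)
    (i : Fin (3 * n)) : IsMin π i ↔ i.val < n := by
  have hc := h.card_isMin
  constructor
  · intro hi
    have : (Finset.Iic i) ⊆ Finset.univ.filter (IsMin π) := by
      intro j hj
      simp only [Finset.mem_Iic] at hj
      simp only [Finset.mem_filter, Finset.mem_univ, true_and]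
      by_contra hj'
      exact absurd (hi.lt_of_not_isMin h hπ hj') (by omega)
    have := Finset.card_le_card this
    rw [Fin.card_Iic, hc] at this
    omega
  · intro hi
    by_contra hn
    have : Finset.univ.filter (IsMin π) ⊆ Finset.Iio i := by
      intro j hj
      simp only [Finset.mem_filter, Finset.mem_univ, true_and] at hj
      exact Finset.mem_Iio.2 (hj.lt_of_not_isMin h hπ hn)
    have := Finset.card_le_card this
    rw [Fin.card_Iio, hc] at this
    omega

theorem IsThree.le_apply {n : ℕ} {π : Perm (Fin (3 * n))} (h : IsThree π) (hπ : No132 π)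
    {i : Fin (3 * n)} (hi : i.val < n) : n ≤ (π i).val ∧ n ≤ (π (π i)).val := by
  have h1 := (isMin_iff_lt h hπ i).2 hi
  constructor
  · by_contra hc
    have h2 := (isMin_iff_lt h hπ (π i)).2 (by omega)
    have := h2.2
    rw [(h i).2] at this
    have := h1.1
    omega
  · by_contra hc
    have h2 := (isMin_iff_lt h hπ (π (π i))).2 (by omega)
    have := h2.1
    rw [(h i).2] at this
    have := h1.2
    omega

theorem IsThree.exists_lt {n : ℕ} {π : Perm (Fin (3 * n))} (h : IsThree π) (hπ : No132 π)
    (j : Fin (3 * n)) : ∃ i : Fin (3 * n), i.val < n ∧ (j = i ∨ j = π i ∨ j = π (π i)) := by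
  have h0 := h j
  have h1 := (h (π j)).1
  have h2 := h.apply_apply_ne j
  by_cases c1 : IsMin π j
  · exact ⟨j, (isMin_iff_lt h hπ j).1 c1, Or.inl rfl⟩
  by_cases c2 : IsMin π (π j)
  · exact ⟨π j, (isMin_iff_lt h hπ _).1 c2, Or.inr (Or.inr h0.2.symm)⟩
  · refine ⟨π (π j), (isMin_iff_lt h hπ _).1 ?_, Or.inr (Or.inl h0.2.symm)⟩
    unfold IsMin at *
    rw [(h (π j)).2] at *
    rw [h0.2] at *
    constructor <;> omega

/-! ### Inversion and the nesting of cycles -/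

theorem IsThree.inv_apply {n : ℕ} {π : Perm (Fin n)} (h : IsThree π) (i : Fin n) :
    π⁻¹ i = π (π i) := by
  rw [Perm.inv_eq_iff_eq]
  exact (h i).2.symm

theorem IsThree.inv {n : ℕ} {π : Perm (Fin n)} (h : IsThree π) : IsThree π⁻¹ := by
  intro i
  simp only [h.inv_apply]
  exact ⟨h.apply_apply_ne i, by rw [(h _).2, (h i).2]⟩

theorem No132.inv {n : ℕ} {π : Perm (Fin n)} (h : No132 π) : No132 π⁻¹ := by
  intro i j k hij hjk h1 h2
  exact h (π⁻¹ i) (π⁻¹ k) (π⁻¹ j) h1 h2 (by simpa using hij) (by simpa using hjk)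

/-- A `312` cycle encloses every `231` cycle with a larger smallest element. -/
theorem apply_apply_lt_of_312_231 {n : ℕ} {π : Perm (Fin (3 * n))} (h : IsThree π) (hπ : No132 π)
    {i j : Fin (3 * n)} (hij : i < j) (hj : j.val < n) (hi' : π (π i) < π i)
    (hj' : π j < π (π j)) : π (π j) < π (π i) := by
  have hi3 := (h i).2
  have hj3 := (h j).2
  obtain ⟨n1, n2⟩ := h.le_apply hπ (i := i) (by omega)
  obtain ⟨n3, n4⟩ := h.le_apply hπ hj
  by_contra hc
  have e1 : π (π i) ≠ π (π j) := fun e => hij.ne (π.injective (π.injective e))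
  have e2 : π (π j) ≠ π i := fun e => by
    have := π.injective e
    omega
  have e3 : π (π i) ≠ π j := fun e => by
    have := π.injective e
    omega
  rcases lt_or_gt_of_ne e2 with h1 | h1
  · rcases lt_or_gt_of_ne e3 with h2 | h2
    · exact hπ (π (π i)) (π j) (π (π j)) h2 (by omega) (by omega) (by omega)
    · exact hπ j (π j) (π i) (by omega) (by omega) (by omega) (by omega)
  · exact hπ (π (π i)) (π i) (π (π j)) (by omega) (by omega) (by omega) (by omega)

theorem apply_lt_of_231_312 {n : ℕ} {π : Perm (Fin (3 * n))} (h : IsThree π) (hπ : No132 π)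
    {i j : Fin (3 * n)} (hij : i < j) (hj : j.val < n) (hi' : π i < π (π i))
    (hj' : π (π j) < π j) : π j < π i := by
  have := apply_apply_lt_of_312_231 h.inv hπ.inv hij hj
  simp only [h.inv_apply, (h _).2] at this
  exact this hi' hj'

/-! ### The initial run of 312 cycles -/

/-- The permutations of `avStar n` whose first `x` cycles are of the form `312`, the next one (if
any) being of the form `231`. -/
def run (n x : ℕ) : Set (Perm (Fin (3 * n))) :=
  {π | π ∈ avStar n pattern132 ∧ (∀ i, i.val < x → π (π i) < π i) ∧
    ∀ i, i.val = x → x < n → π i < π (π i)}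

/-- A later 231 cycle is enclosed directly. A later 312 cycle is bounded through the 231 cycle of
`x`: it lies below `π x`, by the inverse form of the nesting lemma, and that cycle is itself
enclosed by the cycle of `i`. -/
theorem run_lt {n x : ℕ} {π : Perm (Fin (3 * n))} (h : IsThree π) (hπ : No132 π)
    (h1 : ∀ i, i.val < x → π (π i) < π i) (h2 : ∀ i, i.val = x → x < n → π i < π (π i))
    {i j : Fin (3 * n)} (hi : i.val < x) (hj : x ≤ j.val) (hjn : j.val < n) :
    π j < π (π i) ∧ π (π j) < π (π i) := by
  have hj1 := (h (π j)).1
  have hi1 := h1 i hi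
  rcases lt_or_gt_of_ne hj1 with hA | hB
  · have hx : x ≠ j.val := fun e => by
      have := h2 j e.symm (by omega)
      omega
    have hx2 := h2 ⟨x, by omega⟩ rfl (by omega)
    have a1 := apply_apply_lt_of_312_231 h hπ (i := i) (j := ⟨x, by omega⟩)
      (Fin.lt_def.2 (by simpa using hi)) (by simp; omega) hi1 hx2
    have a2 := apply_lt_of_231_312 h hπ (i := ⟨x, by omega⟩) (j := j)
      (Fin.lt_def.2 (by simp; omega)) hjn hx2 hA
    constructor <;> omega
  · have := apply_apply_lt_of_312_231 h hπ (i := i) (j := j) (by omega) hjn hi1 hB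
    constructor <;> omega

theorem card_images {n : ℕ} {π : Perm (Fin (3 * n))} (h : IsThree π) (hπ : No132 π)
    (K : Finset (Fin (3 * n))) (hK : ∀ i ∈ K, i.val < n) :
    (K.image π ∪ K.image (fun i => π (π i))).card = 2 * K.card ∧
    (K ∪ (K.image π ∪ K.image (fun i => π (π i)))).card = 3 * K.card := by
  have c1 : (K.image π).card = K.card := Finset.card_image_of_injective _ π.injective
  have c2 : (K.image (fun i => π (π i))).card = K.card :=
    Finset.card_image_of_injective _ (π.injective.comp π.injective)
  have c3 : (K.image π ∪ K.image (fun i => π (π i))).card = 2 * K.card := by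
    rw [Finset.card_union_of_disjoint, c1, c2]
    · omega
    · rw [Finset.disjoint_left]
      simp only [Finset.mem_image]
      rintro _ ⟨a, ha, rfl⟩ ⟨b, hb, e⟩
      have e := π.injective e
      have := (h.le_apply hπ (hK b hb)).1
      have := hK a ha
      rw [e] at *
      omega
  refine ⟨c3, ?_⟩
  rw [Finset.card_union_of_disjoint, c3]
  · omega
  · rw [Finset.disjoint_left]
    simp only [Finset.mem_image, Finset.mem_union]
    rintro a ha (⟨b, hb, rfl⟩ | ⟨b, hb, rfl⟩)
    · have := (h.le_apply hπ (hK b hb)).1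
      have := hK _ ha
      omega
    · have := (h.le_apply hπ (hK b hb)).2
      have := hK _ ha
      omega

/-- Both bounds are cardinality counts. An element of a later cycle has the `2 * x` larger elements
of the run above it; each of those has below it the `3 * m` elements of the later cycles and the `x`
smallest elements of the run. -/
theorem run_invariant {x m : ℕ} {π : Perm (Fin (3 * (x + m)))} (h : IsThree π) (hπ : No132 π)
    (h1 : ∀ i, i.val < x → π (π i) < π i) (h2 : ∀ i, i.val = x → x < x + m → π i < π (π i))
    {y : Fin (3 * (x + m))} (hy : x ≤ y.val) (hy' : y.val < x + 3 * m) :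
    x ≤ (π y).val ∧ (π y).val < x + 3 * m := by
  have inner : ∀ (j z : Fin (3 * (x + m))), x ≤ j.val → j.val < x + m →
      (z = j ∨ z = π j ∨ z = π (π j)) → x ≤ z.val ∧ z.val < x + 3 * m := by
    intro j z hj hjn hz
    obtain ⟨n1, n2⟩ := h.le_apply hπ hjn
    refine ⟨by rcases hz with rfl | rfl | rfl <;> omega, ?_⟩
    have hsub : ((Finset.univ.filter fun i : Fin (3 * (x + m)) => i.val < x).image π ∪
        (Finset.univ.filter fun i : Fin (3 * (x + m)) => i.val < x).image (fun i => π (π i))) ⊆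
        Finset.Ioi z := by
      intro w hw
      simp only [Finset.mem_union, Finset.mem_image, Finset.mem_filter, Finset.mem_univ,
        true_and] at hw
      rw [Finset.mem_Ioi]
      have key : ∀ i : Fin (3 * (x + m)), i.val < x → z < π (π i) ∧ z < π i := by
        intro i hi
        obtain ⟨l1, l2⟩ := run_lt h hπ h1 h2 hi hj hjn
        have := h1 i hi
        have := (h.le_apply hπ (i := i) (by omega)).2
        rcases hz with rfl | rfl | rfl <;> constructor <;> omega
      rcases hw with ⟨i, hi, rfl⟩ | ⟨i, hi, rfl⟩
      · exact (key i hi).2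
      · exact (key i hi).1
    have hc := Finset.card_le_card hsub
    rw [(card_images h hπ _ (by simp; omega)).1, Fin.card_Ioi, Fin.card_filter_val_lt] at hc
    rw [min_eq_right (by omega)] at hc
    have := z.isLt
    omega
  have outer : ∀ (i z : Fin (3 * (x + m))), i.val < x → (z = π i ∨ z = π (π i)) →
      x + 3 * m ≤ z.val := by
    intro i z hi hz
    have hsub : ((Finset.univ.filter fun j : Fin (3 * (x + m)) => x ≤ j.val ∧ j.val < x + m) ∪
        ((Finset.univ.filter fun j : Fin (3 * (x + m)) => x ≤ j.val ∧ j.val < x + m).image π ∪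
        (Finset.univ.filter fun j : Fin (3 * (x + m)) => x ≤ j.val ∧ j.val < x + m).image
          (fun i => π (π i)))) ∪ Finset.univ.filter (fun j : Fin (3 * (x + m)) => j.val < x) ⊆
        Finset.Iio z := by
      intro w hw
      simp only [Finset.mem_union, Finset.mem_image, Finset.mem_filter, Finset.mem_univ,
        true_and] at hw
      rw [Finset.mem_Iio]
      have key : ∀ j : Fin (3 * (x + m)), x ≤ j.val ∧ j.val < x + m →
          π (π j) < z ∧ π j < z := by
        intro j hj
        obtain ⟨l1, l2⟩ := run_lt h hπ h1 h2 hi hj.1 hj.2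
        have := h1 i hi
        rcases hz with rfl | rfl <;> constructor <;> omega
      obtain ⟨n1, n2⟩ := h.le_apply hπ (i := i) (by omega)
      have hzn : x + m ≤ z.val := by rcases hz with rfl | rfl <;> assumption
      rcases hw with (hj | ⟨j, hj, rfl⟩ | ⟨j, hj, rfl⟩) | hj
      · omega
      · exact (key j hj).2
      · exact (key j hj).1
      · omega
    have hc := Finset.card_le_card hsub
    have hK : (Finset.univ.filter fun j : Fin (3 * (x + m)) =>
        x ≤ j.val ∧ j.val < x + m).card = m := by
      have e : (Finset.univ.filter fun j : Fin (3 * (x + m)) => x ≤ j.val ∧ j.val < x + m) =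
          (Finset.univ.filter fun j : Fin (3 * (x + m)) => j.val < x + m) \
          (Finset.univ.filter fun j : Fin (3 * (x + m)) => j.val < x) := by
        ext j
        simp
        omega
      rw [e, Finset.card_sdiff_of_subset, Fin.card_filter_val_lt, Fin.card_filter_val_lt]
      · omega
      · intro j
        simp
        omega
    rw [Finset.card_union_of_disjoint, (card_images h hπ _ (by simp)).2, Fin.card_Iio, hK,
      Fin.card_filter_val_lt] at hc
    · rw [min_eq_right (by omega)] at hc
      omega
    · rw [Finset.disjoint_left]
      simp only [Finset.mem_image, Finset.mem_union, Finset.mem_filter, Finset.mem_univ, true_and]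
      rintro _ (hj | ⟨j, hj, rfl⟩ | ⟨j, hj, rfl⟩) hw
      · omega
      · have := h.le_apply hπ hj.2
        omega
      · have := h.le_apply hπ hj.2
        omega
  obtain ⟨i, hi, hc⟩ := h.exists_lt hπ y
  have hix : x ≤ i.val := by
    by_contra hlt
    rcases hc with hc | hc
    · subst hc
      omega
    · have := outer i y (by omega) hc
      omega
  refine inner i _ hix hi ?_
  have := (h i).2
  rcases hc with rfl | rfl | rfl <;> simp [this]

/-! ### Gluing a permutation into a run of 312 cycles -/

/-- Underlying function of `insertEquiv`: the second summand spreads around an interval of length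
`3 * m`, starting at `x`, which is the image of the first summand. -/
def insertFun (x m : ℕ) : Fin (3 * m) ⊕ Fin (3 * x) → Fin (3 * (x + m))
  | Sum.inl j => ⟨x + j.val, by omega⟩
  | Sum.inr i => ⟨if i.val < x then i.val else i.val + 3 * m, by split_ifs <;> omega⟩

theorem insertFun_bijective (x m : ℕ) : Function.Bijective (insertFun x m) := by
  rw [Fintype.bijective_iff_injective_and_card]
  constructor
  · rintro (a | a) (b | b) hab <;> simp only [insertFun, Fin.mk.injEq] at hab <;> congr 1 <;>
      (try split_ifs at hab) <;> omega
  · simp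
    omega

noncomputable def insertEquiv (x m : ℕ) : Fin (3 * m) ⊕ Fin (3 * x) ≃ Fin (3 * (x + m)) :=
  Equiv.ofBijective _ (insertFun_bijective x m)

/-- The position of an element of the inner permutation. -/
noncomputable def inner (x m : ℕ) (j : Fin (3 * m)) : Fin (3 * (x + m)) :=
  insertEquiv x m (Sum.inl j)

/-- The position of an element of the outer permutation. -/
noncomputable def outer (x m : ℕ) (i : Fin (3 * x)) : Fin (3 * (x + m)) :=
  insertEquiv x m (Sum.inr i)

theorem inner_val (x m : ℕ) (j : Fin (3 * m)) : (inner x m j).val = x + j.val := rfl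

theorem outer_val (x m : ℕ) (i : Fin (3 * x)) :
    (outer x m i).val = if i.val < x then i.val else i.val + 3 * m := rfl

theorem outer_val_of_lt {x : ℕ} (m : ℕ) {i : Fin (3 * x)} (h : i.val < x) :
    (outer x m i).val = i.val := if_pos h

theorem outer_lt_outer {x m : ℕ} {i j : Fin (3 * x)} : outer x m i < outer x m j ↔ i < j := by
  rw [Fin.lt_def, Fin.lt_def, outer_val, outer_val]
  split_ifs <;> omega

theorem inner_lt_inner {x m : ℕ} {i j : Fin (3 * m)} : inner x m i < inner x m j ↔ i < j := by
  rw [Fin.lt_def, Fin.lt_def, inner_val, inner_val]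
  omega

theorem outer_lt_inner {x m : ℕ} {i : Fin (3 * x)} {j : Fin (3 * m)} :
    outer x m i < inner x m j ↔ i.val < x := by
  rw [Fin.lt_def, outer_val, inner_val]
  split_ifs <;> omega

theorem inner_lt_outer {x m : ℕ} {i : Fin (3 * x)} {j : Fin (3 * m)} :
    inner x m j < outer x m i ↔ x ≤ i.val := by
  rw [Fin.lt_def, outer_val, inner_val]
  split_ifs <;> omega

theorem outer_injective (x m : ℕ) : Function.Injective (outer x m) :=
  (insertEquiv x m).injective.comp Sum.inr_injective

theorem inner_injective (x m : ℕ) : Function.Injective (inner x m) :=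
  (insertEquiv x m).injective.comp Sum.inl_injective

theorem inner_or_outer {x m : ℕ} (y : Fin (3 * (x + m))) :
    (∃ j, y = inner x m j) ∨ ∃ i, y = outer x m i := by
  obtain ⟨z | z, rfl⟩ := (insertEquiv x m).surjective y
  · exact Or.inl ⟨z, rfl⟩
  · exact Or.inr ⟨z, rfl⟩

/-- Insertion of `τ` into `ρ`. -/
noncomputable def glue {x m : ℕ} (τ : Perm (Fin (3 * m))) (ρ : Perm (Fin (3 * x))) :
    Perm (Fin (3 * (x + m))) :=
  (insertEquiv x m).permCongr (Equiv.sumCongr τ ρ)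

@[simp]
theorem glue_inner {x m : ℕ} (τ : Perm (Fin (3 * m))) (ρ : Perm (Fin (3 * x))) (j : Fin (3 * m)) :
    glue τ ρ (inner x m j) = inner x m (τ j) := by
  simp [glue, inner, Equiv.permCongr_apply]

@[simp]
theorem glue_outer {x m : ℕ} (τ : Perm (Fin (3 * m))) (ρ : Perm (Fin (3 * x))) (i : Fin (3 * x)) :
    glue τ ρ (outer x m i) = outer x m (ρ i) := by
  simp [glue, outer, Equiv.permCongr_apply]

theorem glue_injective (x m : ℕ) : Function.Injective
    (fun z : Perm (Fin (3 * m)) × Perm (Fin (3 * x)) => glue z.1 z.2) := by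
  rintro ⟨τ, ρ⟩ ⟨τ', ρ'⟩ h
  refine Prod.ext (Equiv.ext fun j => ?_) (Equiv.ext fun j => ?_)
  · refine inner_injective x m ?_
    rw [← glue_inner τ ρ, ← glue_inner τ' ρ']
    exact congrArg (fun f : Perm _ => f (inner x m j)) h
  · refine outer_injective x m ?_
    rw [← glue_outer τ ρ, ← glue_outer τ' ρ']
    exact congrArg (fun f : Perm _ => f (outer x m j)) h

theorem isThree_glue {x m : ℕ} {τ : Perm (Fin (3 * m))} {ρ : Perm (Fin (3 * x))} :
    IsThree (glue τ ρ) ↔ IsThree τ ∧ IsThree ρ := by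
  constructor
  · intro h
    constructor
    · intro j
      have := h (inner x m j)
      simpa [(inner_injective x m).eq_iff] using this
    · intro j
      have := h (outer x m j)
      simpa [(outer_injective x m).eq_iff] using this
  · rintro ⟨h1, h2⟩ y
    rcases inner_or_outer y with ⟨j, rfl⟩ | ⟨j, rfl⟩
    · simpa [(inner_injective x m).eq_iff] using h1 j
    · simpa [(outer_injective x m).eq_iff] using h2 j

theorem No132.of_glue {x m : ℕ} {τ : Perm (Fin (3 * m))} {ρ : Perm (Fin (3 * x))}
    (h : No132 (glue τ ρ)) : No132 τ ∧ No132 ρ := by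
  constructor
  · intro i j k hij hjk h1 h2
    exact h (inner x m i) (inner x m j) (inner x m k) (inner_lt_inner.2 hij) (inner_lt_inner.2 hjk)
      (by simpa [inner_lt_inner] using h1) (by simpa [inner_lt_inner] using h2)
  · intro i j k hij hjk h1 h2
    exact h (outer x m i) (outer x m j) (outer x m k) (outer_lt_outer.2 hij) (outer_lt_outer.2 hjk)
      (by simpa [outer_lt_outer] using h1) (by simpa [outer_lt_outer] using h2)

/-- In a permutation with `312` cycles only, the large values at large positions increase. -/
theorem No231Cycle.increasing {n : ℕ} {π : Perm (Fin (3 * n))} (h : IsThree π) (hπ : No132 π)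
    (hA : No231Cycle π) {j k : Fin (3 * n)} (hj : n ≤ j.val) (hjk : j < k) (hk : n ≤ (π k).val)
    (hlt : π k < π j) : False := by
  obtain ⟨i, hi, hc⟩ := h.exists_lt hπ j
  have h3 := (h i).2
  have h1 := (h (π i)).1
  have hm := (isMin_iff_lt h hπ i).2 hi
  have hA' : ¬ π i < π (π i) := fun hc => hA i hm.1 hc
  rcases hc with rfl | rfl | rfl
  · omega
  · exact hπ (π (π i)) (π i) k (by omega) hjk (by omega) hlt
  · omega

/-- An occurrence that mixes the two parts either starts at one of the first `x` positions, whose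
values exceed all inner values, or consists of one inner position followed by two outer ones. The
latter needs a descent among large values at large positions of `ρ`, which `No231Cycle.increasing`
excludes. -/
theorem No132.glue {x m : ℕ} {τ : Perm (Fin (3 * m))} {ρ : Perm (Fin (3 * x))}
    (hτ : No132 τ) (h : IsThree ρ) (hρ : No132 ρ) (hA : No231Cycle ρ) : No132 (glue τ ρ) := by
  have hup : ∀ i : Fin (3 * x), i.val < x → x ≤ (ρ i).val := fun i hi => (h.le_apply hρ hi).1
  intro i j k hij hjk h1 h2
  rcases inner_or_outer i with ⟨i, rfl⟩ | ⟨i, rfl⟩ <;>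
  rcases inner_or_outer j with ⟨j, rfl⟩ | ⟨j, rfl⟩ <;>
  rcases inner_or_outer k with ⟨k, rfl⟩ | ⟨k, rfl⟩ <;>
  simp only [glue_inner, glue_outer, inner_lt_inner, outer_lt_outer, inner_lt_outer,
    outer_lt_inner] at hij hjk h1 h2
  · exact hτ i j k hij hjk h1 h2
  · omega
  · omega
  · exact hA.increasing h hρ hij hjk h1 h2
  · have := hup i hij
    omega
  · have := hup i hij
    omega
  · have := hup i (by omega)
    omega
  · exact hρ i j k hij hjk h1 h2

theorem run_add_eq_image (x m : ℕ) : run (x + m) x =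
    (fun z : Perm (Fin (3 * m)) × Perm (Fin (3 * x)) => glue z.1 z.2) '' (run m 0 ×ˢ setA x) := by
  ext π
  constructor
  · rintro ⟨hπ, h1, h2⟩
    rw [mem_avStar_iff] at hπ
    obtain ⟨h, hπ⟩ := hπ
    obtain ⟨⟨τ, ρ⟩, he⟩ := Perm.mem_sumCongrHom_range_of_perm_mapsTo_inl
      (σ := (insertEquiv x m).symm.permCongr π) (by
        rintro _ ⟨j, rfl⟩
        have hj : x ≤ (inner x m j).val ∧ (inner x m j).val < x + 3 * m := by
          rw [inner_val]
          omega
        obtain ⟨l1, l2⟩ := run_invariant h hπ h1 h2 hj.1 hj.2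
        refine ⟨⟨(π (inner x m j)).val - x, by omega⟩, ?_⟩
        rw [Equiv.permCongr_apply, Equiv.symm_symm, Equiv.eq_symm_apply]
        apply Fin.ext
        change (inner x m _).val = (π (inner x m j)).val
        rw [inner_val]
        simp
        omega)
    have hg : glue τ ρ = π := by
      have : (insertEquiv x m).permCongr ((insertEquiv x m).symm.permCongr π) = π := by
        ext
        simp [Equiv.permCongr_apply]
      rw [← this, ← he]
      rfl
    subst hg
    have h3 := isThree_glue.1 h
    have h4 := hπ.of_glue
    refine ⟨(τ, ρ), ⟨⟨(mem_avStar_iff τ).2 ⟨h3.1, h4.1⟩, by simp, ?_⟩,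
      (mem_setA_iff ρ).2 ⟨h3.2, h4.2, ?_⟩⟩, rfl⟩
    · intro i hi hm
      have := h2 (inner x m i) (by rw [inner_val]; omega) (by omega)
      simpa [inner_lt_inner] using this
    · intro i hi1 hi2
      have hix := (isMin_iff_lt h3.2 h4.2 i).1 ⟨hi1, hi1.trans hi2⟩
      have := h1 (outer x m i) (by rw [outer_val_of_lt m hix]; omega)
      simp only [glue_outer, outer_lt_outer] at this
      omega
  · rintro ⟨⟨τ, ρ⟩, ⟨⟨hτ, -, h2⟩, hρ⟩, rfl⟩
    simp only at *
    rw [mem_avStar_iff] at hτ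
    rw [mem_setA_iff] at hρ
    refine ⟨(mem_avStar_iff _).2 ⟨isThree_glue.2 ⟨hτ.1, hρ.1⟩, hτ.2.glue hρ.1 hρ.2.1 hρ.2.2⟩,
      ?_, ?_⟩
    · intro i hi
      rcases inner_or_outer i with ⟨i, rfl⟩ | ⟨i, rfl⟩
      · rw [inner_val] at hi
        omega
      · simp only [glue_outer, outer_lt_outer]
        have hix : i.val < x := by
          rw [outer_val] at hi
          split_ifs at hi <;> omega
        have hm := (isMin_iff_lt hρ.1 hρ.2.1 i).2 hix
        have : ¬ ρ i < ρ (ρ i) := hρ.2.2 i hm.1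
        have := (hρ.1 (ρ i)).1
        omega
    · intro i hi hm
      rcases inner_or_outer i with ⟨i, rfl⟩ | ⟨i, rfl⟩
      · simp only [glue_inner, inner_lt_inner]
        rw [inner_val] at hi
        exact h2 i (by omega) (by omega)
      · rw [outer_val] at hi
        split_ifs at hi <;> omega

/-! ### The recursion for the number of permutations -/

theorem ncard_run_add (x m : ℕ) :
    (run (x + m) x).ncard = (setA x).ncard * (run m 0).ncard := by
  rw [run_add_eq_image, Set.ncard_image_of_injective _ (glue_injective x m), Set.ncard_prod,
    mul_comm]

theorem exists_mem_run {n : ℕ} {π : Perm (Fin (3 * n))} (h : π ∈ avStar n pattern132) :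
    ∃ x ≤ n, π ∈ run n x := by
  have h' := (mem_avStar_iff π).1 h
  by_cases hB : ∃ x, ∃ hx : x < n, π ⟨x, by omega⟩ < π (π ⟨x, by omega⟩)
  · classical
    obtain ⟨hx, hlt⟩ := Nat.find_spec hB
    refine ⟨Nat.find hB, hx.le, h, ?_, ?_⟩
    · intro i hi
      have h1 := Nat.find_min hB hi
      have h2 := (h'.1 (π i)).1
      by_contra hc
      exact h1 ⟨by omega, by simp only [Fin.eta]; omega⟩
    · intro i hi _
      have : i = ⟨Nat.find hB, by omega⟩ := Fin.ext hi
      rw [this]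
      exact hlt
  · refine ⟨n, le_rfl, h, ?_, fun i _ hn => absurd hn (lt_irrefl n)⟩
    intro i hi
    have h2 := (h'.1 (π i)).1
    by_contra hc
    exact hB ⟨i, hi, by simp only [Fin.eta]; omega⟩

theorem run_disjoint {n x y : ℕ} (hxy : x < y) (hy : y ≤ n) : Disjoint (run n x) (run n y) := by
  rw [Set.disjoint_left]
  rintro π ⟨-, -, h1⟩ ⟨-, h2, -⟩
  have a := h1 ⟨x, by omega⟩ rfl (by omega)
  have b := h2 ⟨x, by omega⟩ hxy
  omega

theorem ncard_biUnion_run (n : ℕ) (s : Finset ℕ) (hs : ∀ x ∈ s, x ≤ n) :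
    (⋃ x ∈ s, run n x).ncard = ∑ x ∈ s, (setA x).ncard * (run (n - x) 0).ncard := by
  induction s using Finset.induction_on with
  | empty => simp
  | insert a s ha ih =>
    rw [Finset.set_biUnion_insert, Set.ncard_union_eq, ih fun x hx => hs x (by simp [hx]),
      Finset.sum_insert ha]
    · congr 1
      obtain ⟨m, rfl⟩ := Nat.exists_eq_add_of_le (hs a (by simp))
      rw [ncard_run_add, Nat.add_sub_cancel_left]
    · simp only [Set.disjoint_iUnion_right]
      intro x hx
      have : x ≠ a := fun e => ha (e ▸ hx)
      rcases lt_or_gt_of_ne this with h | h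
      · exact (run_disjoint h (hs a (by simp))).symm
      · exact run_disjoint h (hs x (by simp [hx]))

/-- Inversion flips the form of the first cycle, so it maps the permutations starting with a 231
cycle onto those with a nonempty initial run of 312 cycles. -/
theorem ncard_run_zero {n : ℕ} (hn : 1 ≤ n) : (run n 0).ncard =
    ∑ x ∈ Finset.Icc 1 n, (setA x).ncard * (run (n - x) 0).ncard := by
  rw [← ncard_biUnion_run n _ (by simp)]
  rw [← Set.ncard_image_of_injective (run n 0) (inv_injective (G := Perm (Fin (3 * n))))]
  congr 1
  ext π
  simp only [Set.mem_image, Set.mem_iUnion, exists_prop, Finset.mem_Icc]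
  constructor
  · rintro ⟨σ, ⟨hσ, -, h2⟩, rfl⟩
    have hσ' := (mem_avStar_iff σ).1 hσ
    obtain ⟨x, hx, hr⟩ := exists_mem_run ((mem_avStar_iff σ⁻¹).2 ⟨hσ'.1.inv, hσ'.2.inv⟩)
    refine ⟨x, ⟨?_, hx⟩, hr⟩
    by_contra h0
    have h0 : x = 0 := by omega
    subst h0
    have a := hr.2.2 ⟨0, by omega⟩ rfl hn
    have b := h2 ⟨0, by omega⟩ rfl hn
    simp only [hσ'.1.inv_apply, (hσ'.1 _).2] at a
    omega
  · rintro ⟨x, ⟨hx1, hx2⟩, h, h1, -⟩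
    have h' := (mem_avStar_iff π).1 h
    refine ⟨π⁻¹, ⟨(mem_avStar_iff _).2 ⟨h'.1.inv, h'.2.inv⟩, by simp, ?_⟩, inv_inv _⟩
    intro i hi _
    simp only [h'.1.inv_apply, (h'.1 _).2]
    exact h1 i (by omega)

theorem ncard_run_zero_zero : (run 0 0).ncard = 1 := by
  have : run 0 0 = {1} := by
    ext π
    simp only [Set.mem_singleton_iff]
    constructor
    · intro _
      ext i
      exact absurd i.isLt (by omega)
    · rintro rfl
      refine ⟨(mem_avStar_iff _).2 ⟨fun i => ?_, fun i => ?_⟩, fun i => ?_, fun i => ?_⟩ <;>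
        exact absurd i.isLt (by omega)
  rw [this, Set.ncard_singleton]

theorem ncard_avStar {n : ℕ} (hn : 1 ≤ n) :
    (avStar n pattern132).ncard = 2 * (run n 0).ncard := by
  have h1 : avStar n pattern132 = ⋃ x ∈ insert 0 (Finset.Icc 1 n), run n x := by
    ext π
    simp only [Set.mem_iUnion, exists_prop, Finset.mem_Icc, Finset.mem_insert]
    constructor
    · intro h
      obtain ⟨x, hx, hr⟩ := exists_mem_run h
      exact ⟨x, by omega, hr⟩
    · rintro ⟨x, -, hr⟩
      exact hr.1
  rw [h1, ncard_biUnion_run n _ (by simp), Finset.sum_insert (by simp),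
    ← ncard_run_zero hn, Nat.sub_zero]
  -- The degenerate gluing reads `1 = (setA 0).ncard * 1`.
  have h0 : (setA 0).ncard = 1 := by
    have := ncard_run_add 0 0
    simp only [Nat.add_zero] at this
    rw [ncard_run_zero_zero] at this
    omega
  rw [h0]
  omega

/-! ### Sums over compositions -/

/-- Adding a first block to a composition. -/
def consBlock (n : ℕ) (z : Σ x : Fin (n + 1), Composition (n - x.val)) : Composition (n + 1) where
  blocks := (z.1.val + 1) :: z.2.blocks
  blocks_pos := by
    intro i hi
    rcases List.mem_cons.1 hi with rfl | hi
    · omega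
    · exact z.2.blocks_pos hi
  blocks_sum := by
    rw [List.sum_cons, z.2.blocks_sum]
    omega

theorem consBlock_bijective (n : ℕ) : Function.Bijective (consBlock n) := by
  constructor
  · rintro ⟨x, c⟩ ⟨y, d⟩ h
    have h : (x.val + 1) :: c.blocks = (y.val + 1) :: d.blocks := congrArg Composition.blocks h
    obtain ⟨h1, h2⟩ := List.cons.inj h
    have h1 : x = y := by omega
    subst h1
    have h2 : c = d := Composition.ext h2
    rw [h2]
  · intro c
    rcases hb : c.blocks with _ | ⟨b, l⟩
    · exact absurd (c.blocks_eq_nil.1 hb) (by omega)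
    · have hs := c.blocks_sum
      rw [hb, List.sum_cons] at hs
      have hp : 0 < b := c.blocks_pos (by simp [hb])
      refine ⟨⟨⟨b - 1, by omega⟩, ⟨l, fun {i} hi => c.blocks_pos (by simp [hb, hi]), ?_⟩⟩, ?_⟩
      · simp
        omega
      · apply Composition.ext
        simp only [consBlock]
        rw [hb, Nat.sub_add_cancel hp]

theorem prod_blocksFun {n : ℕ} (f : ℕ → ℕ) (c : Composition n) :
    ∏ i : Fin c.length, f (c.blocksFun i) = (c.blocks.map f).prod := by
  rw [← List.prod_ofFn, ← c.ofFn_blocksFun, List.map_ofFn]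
  rfl

theorem sum_composition_zero (f : ℕ → ℕ) :
    ∑ c : Composition 0, ∏ i : Fin c.length, f (c.blocksFun i) = 1 := by
  have h : ∀ c : Composition 0, ∏ i : Fin c.length, f (c.blocksFun i) = 1 := by
    intro c
    rw [prod_blocksFun, c.blocks_eq_nil.2 rfl]
    simp
  simp only [h]
  simp [composition_card]

theorem sum_composition_succ (f : ℕ → ℕ) (n : ℕ) :
    ∑ c : Composition (n + 1), ∏ i : Fin c.length, f (c.blocksFun i) =
      ∑ x ∈ Finset.range (n + 1), f (x + 1) *
        ∑ c : Composition (n - x), ∏ i : Fin c.length, f (c.blocksFun i) := by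
  rw [← (consBlock_bijective n).sum_comp, Fintype.sum_sigma,
    Finset.sum_range fun x => f (x + 1) *
        ∑ c : Composition (n - x), ∏ i : Fin c.length, f (c.blocksFun i)]
  refine Finset.sum_congr rfl fun x _ => ?_
  rw [Finset.mul_sum]
  refine Finset.sum_congr rfl fun c _ => ?_
  rw [prod_blocksFun, prod_blocksFun]
  simp [consBlock]

theorem ncard_run_zero_succ (n : ℕ) : (run (n + 1) 0).ncard =
    ∑ x ∈ Finset.range (n + 1), (setA (x + 1)).ncard * (run (n - x) 0).ncard := by
  rw [ncard_run_zero (by omega), ← Finset.Ico_add_one_right_eq_Icc, Finset.sum_Ico_eq_sum_range]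
  refine Finset.sum_congr rfl fun x _ => ?_
  rw [add_comm 1 x, Nat.add_sub_add_right]

theorem ncard_run_zero_eq_sum (n : ℕ) : (run n 0).ncard =
    ∑ c : Composition n, ∏ i : Fin c.length, (setA (c.blocksFun i)).ncard := by
  induction n using Nat.strong_induction_on with
  | _ n ih =>
    rcases n with _ | n
    · rw [ncard_run_zero_zero, sum_composition_zero fun x => (setA x).ncard]
    · rw [ncard_run_zero_succ, sum_composition_succ fun x => (setA x).ncard]
      refine Finset.sum_congr rfl fun x _ => ?_
      rw [ih _ (by omega)]

/-! ### Splitting a 132-avoiding permutation at its maximum -/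

/-- The `132`-avoiding permutations all of whose non-inversions span only positions where `E`
holds. -/
def avJoined (n : ℕ) (E : ℕ → Prop) : Set (Perm (Fin n)) :=
  {τ | No132 τ ∧ ∀ k l, k < l → τ k < τ l → ∀ j : ℕ, k.val ≤ j → j < l.val → E j}

theorem card_le_of_forall_apply_lt {n : ℕ} (τ : Perm (Fin n)) (P : Finset (Fin n)) (y : Fin n)
    (h : ∀ x ∈ P, τ x < y) : P.card ≤ y.val := by
  rw [← Finset.card_image_of_injective P τ.injective, ← Fin.card_Iio]
  refine Finset.card_le_card fun z hz => ?_
  obtain ⟨x, hx, rfl⟩ := Finset.mem_image.1 hz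
  exact Finset.mem_Iio.2 (h x hx)

theorem card_le_of_forall_lt_apply {n : ℕ} (τ : Perm (Fin n)) (P : Finset (Fin n)) (y : Fin n)
    (h : ∀ x ∈ P, y < τ x) : P.card ≤ n - 1 - y.val := by
  rw [← Finset.card_image_of_injective P τ.injective, ← Fin.card_Ioi]
  refine Finset.card_le_card fun z hz => ?_
  obtain ⟨x, hx, rfl⟩ := Finset.mem_image.1 hz
  exact Finset.mem_Ioi.2 (h x hx)

/-- Positions in a permutation split at its maximum. -/
def splitPos (i s : ℕ) : Fin i ⊕ (Fin s ⊕ Unit) → Fin (i + s + 1)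
  | Sum.inl k => ⟨k.val, by omega⟩
  | Sum.inr (Sum.inl k) => ⟨i + 1 + k.val, by omega⟩
  | Sum.inr (Sum.inr _) => ⟨i, by omega⟩

/-- Values in a `132`-avoiding permutation split at its maximum. -/
def splitVal (i s : ℕ) : Fin i ⊕ (Fin s ⊕ Unit) → Fin (i + s + 1)
  | Sum.inl k => ⟨s + k.val, by omega⟩
  | Sum.inr (Sum.inl k) => ⟨k.val, by omega⟩
  | Sum.inr (Sum.inr _) => ⟨i + s, by omega⟩

theorem splitPos_bijective (i s : ℕ) : Function.Bijective (splitPos i s) := by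
  rw [Fintype.bijective_iff_injective_and_card]
  constructor
  · rintro (a | a | a) (b | b | b) hab <;> simp only [splitPos, Fin.mk.injEq] at hab <;>
      first | (exfalso; omega) | (congr <;> omega)
  · simp
    omega

theorem splitVal_bijective (i s : ℕ) : Function.Bijective (splitVal i s) := by
  rw [Fintype.bijective_iff_injective_and_card]
  constructor
  · rintro (a | a | a) (b | b | b) hab <;> simp only [splitVal, Fin.mk.injEq] at hab <;>
      first | (exfalso; omega) | (congr <;> omega)
  · simp
    omega

/-- The permutation `L max R`, with the letters of `L` above those of `R`. -/
noncomputable def joinMax {i s : ℕ} (L : Perm (Fin i)) (R : Perm (Fin s)) :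
    Perm (Fin (i + s + 1)) :=
  ((Equiv.ofBijective _ (splitPos_bijective i s)).symm.trans
    (Equiv.sumCongr L (Equiv.sumCongr R (Equiv.refl _)))).trans
    (Equiv.ofBijective _ (splitVal_bijective i s))

theorem joinMax_splitPos {i s : ℕ} (L : Perm (Fin i)) (R : Perm (Fin s))
    (z : Fin i ⊕ (Fin s ⊕ Unit)) : joinMax L R (splitPos i s z) =
      splitVal i s (Equiv.sumCongr L (Equiv.sumCongr R (Equiv.refl _)) z) := by
  have : splitPos i s z = (Equiv.ofBijective _ (splitPos_bijective i s)) z := rfl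
  rw [this]
  simp [joinMax]

theorem joinMax_injective (i s : ℕ) : Function.Injective
    (fun z : Perm (Fin i) × Perm (Fin s) => joinMax z.1 z.2) := by
  rintro ⟨L, R⟩ ⟨L', R'⟩ h
  have h' : ∀ z, splitVal i s (Equiv.sumCongr L (Equiv.sumCongr R (Equiv.refl _)) z) =
      splitVal i s (Equiv.sumCongr L' (Equiv.sumCongr R' (Equiv.refl _)) z) := by
    intro z
    rw [← joinMax_splitPos, ← joinMax_splitPos]
    exact congrArg (fun f : Perm _ => f (splitPos i s z)) h
  refine Prod.ext (Equiv.ext fun k => ?_) (Equiv.ext fun k => ?_)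
  · simpa using (splitVal_bijective i s).injective (h' (Sum.inl k))
  · simpa using (splitVal_bijective i s).injective (h' (Sum.inr (Sum.inl k)))

/-- A letter before the maximum exceeds every letter after it, as otherwise the three form a 132.
Counting then puts the left values into `[s, i + s)` and the right values into `[0, s)`. -/
theorem exists_joinMax {i s : ℕ} {τ : Perm (Fin (i + s + 1))} (h : No132 τ)
    (hi : (τ ⟨i, by omega⟩).val = i + s) : ∃ L R, joinMax L R = τ := by
  have hlt : ∀ k : Fin (i + s + 1), k.val ≠ i → τ k < τ ⟨i, by omega⟩ := by
    intro k hk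
    have h1 : τ k ≠ τ ⟨i, by omega⟩ := fun e => hk (Fin.val_eq_of_eq (τ.injective e))
    have := (τ k).isLt
    omega
  have hlr : ∀ k l : Fin (i + s + 1), k.val < i → i < l.val → τ l < τ k := by
    intro k l hk hl
    by_contra hc
    have h1 : τ k ≠ τ l := fun e => by
      have := τ.injective e
      omega
    exact h k ⟨i, by omega⟩ l (Fin.lt_def.2 hk) (Fin.lt_def.2 hl) (by omega) (hlt l (by omega))
  have hr : ∀ l : Fin (i + s + 1), i < l.val → (τ l).val < s := by
    intro l hl
    have := card_le_of_forall_lt_apply τ (Finset.univ.filter fun k => k.val < i + 1) (τ l) (by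
      intro k hk
      simp only [Finset.mem_filter, Finset.mem_univ, true_and] at hk
      rcases Nat.lt_succ_iff_lt_or_eq.1 hk with hk | hk
      · exact hlr k l hk hl
      · have : k = ⟨i, by omega⟩ := Fin.ext hk
        rw [this]
        exact hlt l (by omega))
    rw [Fin.card_filter_val_lt, min_eq_right (by omega)] at this
    have := l.isLt
    omega
  have hl : ∀ k : Fin (i + s + 1), k.val < i → s ≤ (τ k).val := by
    intro k hk
    have := card_le_of_forall_apply_lt τ (Finset.Ioi ⟨i, by omega⟩) (τ k) (by
      intro l hl
      exact hlr k l hk (Fin.lt_def.1 (Finset.mem_Ioi.1 hl)))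
    rw [Fin.card_Ioi] at this
    simp only at this
    omega
  have hL : Function.Injective (fun k : Fin i => (⟨(τ (splitPos i s (Sum.inl k))).val - s, by
      have h1 := hlt (splitPos i s (Sum.inl k)) (by simp [splitPos]; omega)
      have := k.isLt
      rw [Fin.lt_def, hi] at h1
      omega⟩ : Fin i)) := by
    intro a b hab
    simp only [Fin.mk.injEq] at hab
    have h1 := hl (splitPos i s (Sum.inl a)) (by simp [splitPos])
    have h2 := hl (splitPos i s (Sum.inl b)) (by simp [splitPos])
    have h3 : τ (splitPos i s (Sum.inl a)) = τ (splitPos i s (Sum.inl b)) := by omega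
    simpa using (splitPos_bijective i s).injective (τ.injective h3)
  have hR : Function.Injective (fun k : Fin s => (⟨(τ (splitPos i s (Sum.inr (Sum.inl k)))).val,
      hr _ (by simp [splitPos]; omega)⟩ : Fin s)) := by
    intro a b hab
    simp only [Fin.mk.injEq] at hab
    have h3 : τ (splitPos i s (Sum.inr (Sum.inl a))) = τ (splitPos i s (Sum.inr (Sum.inl b))) := by
      omega
    simpa using (splitPos_bijective i s).injective (τ.injective h3)
  refine ⟨Equiv.ofBijective _ (Finite.injective_iff_bijective.1 hL),
    Equiv.ofBijective _ (Finite.injective_iff_bijective.1 hR), ?_⟩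
  ext x
  obtain ⟨z, rfl⟩ := (splitPos_bijective i s).surjective x
  rw [joinMax_splitPos]
  rcases z with k | k | k
  · have := hl (splitPos i s (Sum.inl k)) (by simp [splitPos])
    simp only [Equiv.sumCongr_apply, Sum.map_inl, Equiv.ofBijective_apply, splitVal]
    omega
  · simp [splitVal]
  · simp only [Equiv.sumCongr_apply, Sum.map_inr, Equiv.refl_apply, splitVal]
    exact hi.symm

/-- No non-inversion crosses from `L` or the maximum into `R`, so step `i`, just after the maximum,
is unconstrained; this is why `E` is shifted by `i + 1` rather than `i`. -/
theorem joinMax_mem_avJoined_iff {i s : ℕ} (L : Perm (Fin i)) (R : Perm (Fin s)) (E : ℕ → Prop) :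
    joinMax L R ∈ avJoined (i + s + 1) E ↔
      (∀ j < i, E j) ∧ L ∈ avJoined i (fun _ => True) ∧
        R ∈ avJoined s (fun j => E (j + (i + 1))) := by
  have e1 : ∀ k, joinMax L R (splitPos i s (Sum.inl k)) = splitVal i s (Sum.inl (L k)) :=
    fun k => joinMax_splitPos L R _
  have e2 : ∀ k, joinMax L R (splitPos i s (Sum.inr (Sum.inl k))) =
      splitVal i s (Sum.inr (Sum.inl (R k))) := fun k => joinMax_splitPos L R _
  have e3 : ∀ k, joinMax L R (splitPos i s (Sum.inr (Sum.inr k))) =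
      splitVal i s (Sum.inr (Sum.inr k)) := fun k => joinMax_splitPos L R _
  constructor
  · rintro ⟨h1, h2⟩
    refine ⟨fun j hj => ?_, ⟨?_, by simp⟩, ?_, ?_⟩
    · refine h2 (splitPos i s (Sum.inl ⟨0, by omega⟩)) (splitPos i s (Sum.inr (Sum.inr ()))) ?_ ?_
        j (by simp [splitPos]) (by simpa [splitPos] using hj)
      · rw [Fin.lt_def]
        simp only [splitPos]
        omega
      · rw [e1, e3, Fin.lt_def]
        simp only [splitVal]
        omega
    · intro a b c hab hbc h3 h4
      refine h1 (splitPos i s (Sum.inl a)) (splitPos i s (Sum.inl b)) (splitPos i s (Sum.inl c))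
        hab hbc ?_ ?_ <;> rw [e1, e1, Fin.lt_def] <;> simp only [splitVal] <;> omega
    · intro a b c hab hbc h3 h4
      refine h1 (splitPos i s (Sum.inr (Sum.inl a))) (splitPos i s (Sum.inr (Sum.inl b)))
        (splitPos i s (Sum.inr (Sum.inl c))) ?_ ?_ ?_ ?_
      · rw [Fin.lt_def]; simp only [splitPos]; omega
      · rw [Fin.lt_def]; simp only [splitPos]; omega
      · rw [e2, e2, Fin.lt_def]; simp only [splitVal]; omega
      · rw [e2, e2, Fin.lt_def]; simp only [splitVal]; omega
    · intro k l hkl hR j hj1 hj2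
      refine h2 (splitPos i s (Sum.inr (Sum.inl k))) (splitPos i s (Sum.inr (Sum.inl l))) ?_ ?_ _
        ?_ ?_
      · rw [Fin.lt_def]; simp only [splitPos]; omega
      · rw [e2, e2, Fin.lt_def]; simp only [splitVal]; omega
      · simp only [splitPos]; omega
      · simp only [splitPos]; omega
  · rintro ⟨hE, ⟨hL, -⟩, hR, hR'⟩
    refine ⟨?_, ?_⟩
    · intro a b c hab hbc h3 h4
      obtain ⟨a, rfl⟩ := (splitPos_bijective i s).surjective a
      obtain ⟨b, rfl⟩ := (splitPos_bijective i s).surjective b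
      obtain ⟨c, rfl⟩ := (splitPos_bijective i s).surjective c
      rcases a with a | a | a <;> rcases b with b | b | b <;> rcases c with c | c | c <;>
        simp only [e1, e2, e3, Fin.lt_def] at hab hbc h3 h4 <;>
        simp only [splitPos, splitVal] at hab hbc h3 h4 <;> (try omega)
      · exact hL a b c (by omega) (by omega) (by omega) (by omega)
      · exact hR a b c (by omega) (by omega) (by omega) (by omega)
    · intro a b hab h3 j hj1 hj2
      obtain ⟨a, rfl⟩ := (splitPos_bijective i s).surjective a
      obtain ⟨b, rfl⟩ := (splitPos_bijective i s).surjective b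
      rcases a with a | a | a <;> rcases b with b | b | b <;>
        simp only [e1, e2, e3, Fin.lt_def] at hab h3 <;>
        simp only [splitPos, splitVal] at hab h3 hj1 hj2 <;> (try omega)
      · exact hE j (by omega)
      · exact hE j (by omega)
      · have := hR' a b (by omega) (by omega) (j - (i + 1)) (by omega) (by omega)
        simpa [Nat.sub_add_cancel (show i + 1 ≤ j by omega)] using this

open Classical in
theorem ncard_avJoined_max (m i : ℕ) (hi : i ≤ m) (E : ℕ → Prop) :
    {τ ∈ avJoined (m + 1) E | (τ ⟨i, by omega⟩).val = m}.ncard =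
      if ∀ j < i, E j then (avJoined i (fun _ => True)).ncard *
        (avJoined (m - i) (fun j => E (j + (i + 1)))).ncard else 0 := by
  obtain ⟨s, rfl⟩ := Nat.exists_eq_add_of_le hi
  rw [Nat.add_sub_cancel_left]
  have e : {τ ∈ avJoined (i + s + 1) E | (τ ⟨i, by omega⟩).val = i + s} =
      (fun z : Perm (Fin i) × Perm (Fin s) => joinMax z.1 z.2) ''
        {z | (∀ j < i, E j) ∧ z.1 ∈ avJoined i (fun _ => True) ∧
          z.2 ∈ avJoined s (fun j => E (j + (i + 1)))} := by
    ext τ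
    constructor
    · rintro ⟨h1, h2⟩
      obtain ⟨L, R, rfl⟩ := exists_joinMax h1.1 h2
      exact ⟨(L, R), (joinMax_mem_avJoined_iff L R E).1 h1, rfl⟩
    · rintro ⟨⟨L, R⟩, h, rfl⟩
      refine ⟨(joinMax_mem_avJoined_iff L R E).2 h, ?_⟩
      have := joinMax_splitPos L R (Sum.inr (Sum.inr ()))
      exact congrArg Fin.val this
  rw [e, Set.ncard_image_of_injective _ (joinMax_injective i s)]
  split_ifs with hE
  · rw [← Set.ncard_prod]
    congr 1
    ext z
    exact ⟨fun h => h.2, fun h => ⟨hE, h⟩⟩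
  · rw [Set.ncard_eq_zero]
    ext z
    simp [hE]

open Classical in
theorem ncard_avJoined_succ (m : ℕ) (E : ℕ → Prop) :
    (avJoined (m + 1) E).ncard = ∑ i ∈ Finset.range (m + 1),
      if ∀ j < i, E j then (avJoined i (fun _ => True)).ncard *
        (avJoined (m - i) (fun j => E (j + (i + 1)))).ncard else 0 := by
  have h1 : (avJoined (m + 1) E).ncard = ∑ i : Fin (m + 1),
      {τ ∈ avJoined (m + 1) E | (τ i).val = m}.ncard := by
    -- The fibres are taken over the position of the maximum.
    rw [Set.ncard_eq_toFinset_card', Finset.card_eq_sum_card_fiberwise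
      (f := fun τ : Perm (Fin (m + 1)) => τ⁻¹ ⟨m, by omega⟩) (t := Finset.univ) (by simp)]
    refine Finset.sum_congr rfl fun i _ => ?_
    rw [Set.ncard_eq_toFinset_card']
    congr 1
    ext τ
    simp only [Finset.mem_filter, Set.mem_toFinset, Set.mem_ofPred_eq, Perm.inv_eq_iff_eq]
    rw [Fin.ext_iff, eq_comm]
  rw [h1, Finset.sum_range]
  exact Finset.sum_congr rfl fun i _ => ncard_avJoined_max m i.val (by omega) E

theorem ncard_avJoined_zero (E : ℕ → Prop) : (avJoined 0 E).ncard = 1 := by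
  have : avJoined 0 E = {1} := by
    ext π
    simp only [Set.mem_singleton_iff]
    constructor
    · intro _
      ext i
      exact i.elim0
    · rintro rfl
      exact ⟨fun i => i.elim0, fun i => i.elim0⟩
  rw [this, Set.ncard_singleton]

theorem ncard_avJoined_true (n : ℕ) : (avJoined n (fun _ => True)).ncard = catalan n := by
  induction n using Nat.strong_induction_on with
  | _ n ih =>
    rcases n with _ | n
    · rw [ncard_avJoined_zero, catalan_zero]
    · rw [ncard_avJoined_succ, catalan_succ, Finset.sum_range]
      refine Finset.sum_congr rfl fun i _ => ?_
      rw [if_pos (by simp), ih _ (by omega), ih _ (by omega)]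

theorem avJoined_congr {n : ℕ} {E E' : ℕ → Prop} (h : ∀ j, j + 1 < n → (E j ↔ E' j)) :
    avJoined n E = avJoined n E' := by
  ext τ
  refine and_congr_right fun _ => ?_
  refine forall_congr' fun k => forall_congr' fun l => forall_congr' fun _ => forall_congr' fun _ =>
    forall_congr' fun j => forall_congr' fun _ => forall_congr' fun hj => h j ?_
  have := l.isLt
  omega

/-! ### Weighted lattice paths -/

open Classical in
/-- The words in the alphabet `L`, with steps `wt`, that lead from height `h` to height `0` and
never go below height `0`. -/
noncomputable def paths {L : Type*} [Fintype L] (wt : L → ℤ) (h : ℤ) (n : ℕ) :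
    Finset (Fin n → L) :=
  Finset.univ.filter fun s =>
    (∀ k : ℕ, 0 ≤ h + ∑ i : Fin n with i.val < k, wt (s i)) ∧ h + ∑ i, wt (s i) = 0

section paths

variable {L : Type*} [Fintype L] (wt : L → ℤ)

theorem mem_paths {h : ℤ} {n : ℕ} {s : Fin n → L} : s ∈ paths wt h n ↔
    (∀ k : ℕ, 0 ≤ h + ∑ i : Fin n with i.val < k, wt (s i)) ∧ h + ∑ i, wt (s i) = 0 := by
  simp [paths]

theorem paths_eq_empty {h : ℤ} (hh : h < 0) (n : ℕ) : paths wt h n = ∅ := by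
  ext s
  simp only [mem_paths, Finset.notMem_empty, iff_false, not_and]
  intro hs
  have := hs 0
  simp at this
  omega

theorem cons_mem_paths {h : ℤ} {n : ℕ} (l : L) (s : Fin n → L) :
    (Fin.cons l s : Fin (n + 1) → L) ∈ paths wt h (n + 1) ↔
      0 ≤ h ∧ s ∈ paths wt (h + wt l) n := by
  have e : ∀ k : ℕ, ∑ i : Fin (n + 1) with i.val < k + 1, wt ((Fin.cons l s : Fin (n + 1) → L) i) =
      wt l + ∑ i : Fin n with i.val < k, wt (s i) := by
    intro k
    rw [Finset.sum_filter, Fin.sum_univ_succ, Finset.sum_filter]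
    simp
  rw [mem_paths, mem_paths, Fin.sum_univ_succ]
  simp only [Fin.cons_zero, Fin.cons_succ]
  constructor
  · rintro ⟨h1, h2⟩
    refine ⟨by simpa using h1 0, fun k => ?_, by omega⟩
    have := h1 (k + 1)
    rw [e] at this
    omega
  · rintro ⟨h0, h1, h2⟩
    refine ⟨fun k => ?_, by omega⟩
    rcases k with _ | k
    · simpa using h0
    · rw [e]
      have := h1 k
      omega

theorem sum_paths_succ {h : ℤ} (hh : 0 ≤ h) (n : ℕ) (g : (Fin (n + 1) → L) → ℕ) :
    ∑ s ∈ paths wt h (n + 1), g s =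
      ∑ l, ∑ s ∈ paths wt (h + wt l) n, g (Fin.cons l s) := by
  classical
  have h1 : ∀ (m : ℕ) (k : ℤ) (f : (Fin m → L) → ℕ), ∑ s ∈ paths wt k m, f s =
      ∑ s, if s ∈ paths wt k m then f s else 0 := by
    intro m k f
    rw [Finset.sum_ite_mem, Finset.univ_inter]
  rw [h1, ← (Fin.consEquiv fun _ : Fin (n + 1) => L).sum_comp, Fintype.sum_prod_type]
  refine Finset.sum_congr rfl fun l _ => ?_
  rw [h1]
  refine Finset.sum_congr rfl fun s _ => ?_
  refine if_congr ?_ rfl rfl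
  change (Fin.cons l s : Fin (n + 1) → L) ∈ _ ↔ _
  rw [cons_mem_paths]
  simp [hh]

theorem sum_paths_zero (h : ℤ) (g : (Fin 0 → L) → ℕ) :
    ∑ s ∈ paths wt h 0, g s = if h = 0 then g Fin.elim0 else 0 := by
  split_ifs with h0
  · have : paths wt h 0 = {Fin.elim0} := by
      ext s
      rw [Finset.mem_singleton, mem_paths]
      simp [h0]
      exact Subsingleton.elim _ _
    rw [this, Finset.sum_singleton]
  · have : paths wt h 0 = ∅ := by
      ext s
      simp [mem_paths, h0]
    rw [this, Finset.sum_empty]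

end paths

/-! ### Paths with a compatible permutation -/

/-- The weight of a pair of bits. -/
def bitWeight (l : Bool × Bool) : ℤ := (if l.2 then 1 else 0) - (if l.1 then 1 else 0)

/-- The positions of a word where the letter is `(false, false)`. -/
def flatAt {n : ℕ} (w : Fin n → Bool × Bool) (j : ℕ) : Prop :=
  ∃ hj : j < n, w ⟨j, hj⟩ = (false, false)

theorem flatAt_cons_succ {n : ℕ} (l : Bool × Bool) (w : Fin n → Bool × Bool) (j : ℕ) :
    flatAt (Fin.cons l w : Fin (n + 1) → Bool × Bool) (j + 1) ↔ flatAt w j := by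
  constructor
  · rintro ⟨hj, h⟩
    exact ⟨by omega, h⟩
  · rintro ⟨hj, h⟩
    exact ⟨by omega, h⟩

theorem flatAt_cons_zero {n : ℕ} (l : Bool × Bool) (w : Fin n → Bool × Bool) :
    flatAt (Fin.cons l w : Fin (n + 1) → Bool × Bool) 0 ↔ l = (false, false) := by
  constructor
  · rintro ⟨hj, h⟩
    exact h
  · intro h
    exact ⟨Nat.succ_pos n, h⟩

/-- The number of pairs of a path from height `h` and a compatible permutation. -/
noncomputable def pathPerms (h : ℤ) (n : ℕ) : ℕ :=
  ∑ w ∈ paths bitWeight h n, (avJoined (n + 1) (flatAt w)).ncard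

open Classical in
/-- The part of `pathPerms` that begins with `i` flat letters, a maximum being at position `i`. -/
noncomputable def pathPermsTail (i : ℕ) (h : ℤ) (n : ℕ) : ℕ :=
  ∑ w ∈ paths bitWeight h n, if ∀ j < i, flatAt w j then
    (avJoined (n - i) (fun j => flatAt w (j + (i + 1)))).ncard else 0

/-- A forced flat letter has weight 0 and can be deleted without changing the height or the
condition on the rest. -/
theorem pathPermsTail_succ (i : ℕ) (h : ℤ) (n : ℕ) :
    pathPermsTail (i + 1) h (n + 1) = pathPermsTail i h n := by
  classical
  rcases lt_or_ge h 0 with hh | hh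
  · simp [pathPermsTail, paths_eq_empty _ hh]
  unfold pathPermsTail
  rw [sum_paths_succ _ hh, Fintype.sum_eq_single (false, false)]
  · have : h + bitWeight (false, false) = h := by simp [bitWeight]
    rw [this]
    refine Finset.sum_congr rfl fun w _ => ?_
    rw [Nat.add_sub_add_right]
    refine if_congr ?_ ?_ rfl
    · constructor
      · intro hj j hji
        exact (flatAt_cons_succ _ _ _).1 (hj (j + 1) (by omega))
      · intro hj j hji
        rcases j with _ | j
        · exact (flatAt_cons_zero _ _).2 rfl
        · exact (flatAt_cons_succ _ _ _).2 (hj j (by omega))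
    · congr 2
      ext j
      exact flatAt_cons_succ _ _ _
  · intro l hl
    refine Finset.sum_eq_zero fun w _ => if_neg fun hj => hl ?_
    exact (flatAt_cons_zero l w).1 (hj 0 (by omega))

theorem pathPermsTail_add (i : ℕ) (h : ℤ) (n : ℕ) :
    pathPermsTail i h (n + i) = pathPermsTail 0 h n := by
  induction i with
  | zero => rfl
  | succ i ih => rw [← add_assoc, pathPermsTail_succ, ih]

theorem pathPerms_eq_sum (h : ℤ) (n : ℕ) : pathPerms h n =
    ∑ i ∈ Finset.range (n + 1), catalan i * pathPermsTail 0 h (n - i) := by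
  classical
  unfold pathPerms
  simp only [ncard_avJoined_succ, ncard_avJoined_true]
  rw [Finset.sum_comm]
  refine Finset.sum_congr rfl fun i hi => ?_
  rw [← pathPermsTail_add i, Nat.sub_add_cancel (by simpa [Nat.lt_succ_iff] using hi),
    pathPermsTail, Finset.mul_sum]
  refine Finset.sum_congr rfl fun w _ => ?_
  split_ifs <;> simp

theorem pathPermsTail_zero_zero (h : ℤ) : pathPermsTail 0 h 0 = if h = 0 then 1 else 0 := by
  classical
  unfold pathPermsTail
  rw [sum_paths_zero]
  simp [ncard_avJoined_zero]

/-- The maximum comes first, so the first letter is free. Its four values have weights `-1`, `0`,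
`0`, `1`. -/
theorem pathPermsTail_zero_succ {h : ℤ} (hh : 0 ≤ h) (n : ℕ) : pathPermsTail 0 h (n + 1) =
    pathPerms (h - 1) n + 2 * pathPerms h n + pathPerms (h + 1) n := by
  classical
  unfold pathPermsTail
  rw [sum_paths_succ _ hh]
  refine (Finset.sum_congr rfl fun l _ =>
    (?_ : _ = pathPerms (h + bitWeight l) n)).trans ?_
  · refine Finset.sum_congr rfl fun w _ => ?_
    rw [if_pos (by simp)]
    congr 2
    ext j
    exact flatAt_cons_succ _ _ _
  rw [Fintype.sum_prod_type]
  simp [bitWeight]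
  rw [sub_eq_add_neg]
  ring

theorem pathPerms_of_neg {h : ℤ} (hh : h < 0) (n : ℕ) : pathPerms h n = 0 := by
  simp [pathPerms, paths_eq_empty _ hh]

/-! ### Generating functions -/

open PowerSeries

theorem catalanGF_eq : catalanGF = 1 + X * catalanGF ^ 2 := by
  have h := congrArg (PowerSeries.map (Nat.castRingHom ℚ)) catalanSeries_sq_mul_X_add_one
  have e : PowerSeries.map (Nat.castRingHom ℚ) catalanSeries = catalanGF := by
    ext n
    simp [catalanSeries, catalanGF]
  rw [map_add, map_mul, map_pow, map_one, PowerSeries.map_X, e] at h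
  linear_combination -h

theorem constantCoeff_catalanGF_sub_one : constantCoeff (catalanGF - 1) = 0 := by
  rw [← coeff_zero_eq_constantCoeff_apply]
  simp [catalanGF]

/-- The generating function of `pathPerms`. -/
noncomputable def pathPermsGF (h : ℤ) : PowerSeries ℚ := PowerSeries.mk fun n => (pathPerms h n : ℚ)

theorem pathPermsGF_of_neg {h : ℤ} (hh : h < 0) : pathPermsGF h = 0 := by
  ext n
  simp [pathPermsGF, pathPerms_of_neg hh]

theorem pathPermsGF_eq {h : ℤ} (hh : 0 ≤ h) : pathPermsGF h = catalanGF *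
    ((if h = 0 then 1 else 0) +
      X * (pathPermsGF (h - 1) + 2 * pathPermsGF h + pathPermsGF (h + 1))) := by
  have h1 : pathPermsGF h = catalanGF *
      PowerSeries.mk fun n => (pathPermsTail 0 h n : ℚ) := by
    ext n
    rw [coeff_mul, Finset.Nat.sum_antidiagonal_eq_sum_range_succ_mk, pathPermsGF, coeff_mk,
      pathPerms_eq_sum]
    simp [catalanGF]
  rw [h1]
  congr 1
  rw [← h1]
  ext n
  rcases n with _ | n
  · rw [coeff_mk, pathPermsTail_zero_zero]
    split_ifs <;> simp
  · have h2 : (2 : PowerSeries ℚ) * pathPermsGF h = pathPermsGF h + pathPermsGF h := two_mul _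
    rw [coeff_mk, pathPermsTail_zero_succ hh, map_add, coeff_succ_X_mul, h2]
    have : coeff (n + 1) (if h = 0 then (1 : PowerSeries ℚ) else 0) = 0 := by
      split_ifs <;> simp [coeff_one]
    rw [this]
    simp [pathPermsGF]
    ring

/-- The generating function of the Motzkin paths that start at height `h`. -/
noncomputable def motzkinPathGF (h : ℤ) : PowerSeries ℚ :=
  PowerSeries.mk fun n => ((paths (fun s : SignType => (s : ℤ)) h n).card : ℚ)

theorem motzkinPathGF_zero : motzkinPathGF 0 = motzkinGF := by
  ext n
  simp only [motzkinPathGF, motzkinGF, coeff_mk, motzkin]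
  rw [← Set.ncard_coe_finset]
  congr 2
  ext s
  simp [mem_paths, motzkinPaths]

theorem motzkinPathGF_of_neg {h : ℤ} (hh : h < 0) : motzkinPathGF h = 0 := by
  ext n
  simp [motzkinPathGF, paths_eq_empty _ hh]

theorem motzkinPathGF_eq {h : ℤ} (hh : 0 ≤ h) : motzkinPathGF h =
    (if h = 0 then 1 else 0) +
      X * (motzkinPathGF (h - 1) + motzkinPathGF h + motzkinPathGF (h + 1)) := by
  ext n
  rcases n with _ | n
  · have := sum_paths_zero (fun s : SignType => (s : ℤ)) h (fun _ => 1)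
    rw [Finset.sum_const, smul_eq_mul, mul_one] at this
    rw [motzkinPathGF, coeff_mk, this]
    split_ifs <;> simp
  · have := sum_paths_succ (fun s : SignType => (s : ℤ)) hh n (fun _ => 1)
    simp only [Finset.sum_const, smul_eq_mul, mul_one] at this
    rw [motzkinPathGF, coeff_mk, this, map_add, coeff_succ_X_mul]
    have h0 : coeff (n + 1) (if h = 0 then (1 : PowerSeries ℚ) else 0) = 0 := by
      split_ifs <;> simp [coeff_one]
    have hu : (Finset.univ : Finset SignType) = {0, -1, 1} := rfl
    rw [h0, hu, Finset.sum_insert (by decide), Finset.sum_insert (by decide),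
      Finset.sum_singleton]
    simp [motzkinPathGF, sub_eq_add_neg]
    ring

/-- Both sides are the case `h = 0` of families indexed by the starting height which solve the same
linear system. The system is contracting in the `X`-adic sense, since its coefficient `u` has zero
constant term. -/
theorem seriesA_eq : seriesA = X * pathPermsGF 0 := by
  have hs : HasSubst (catalanGF - 1) :=
    HasSubst.of_constantCoeff_zero' constantCoeff_catalanGF_sub_one
  set u := catalanGF - 1 with hu
  have hc : catalanGF = 1 + u := by rw [hu]; ring
  have hu2 : u = X * catalanGF ^ 2 := by
    rw [hu]
    linear_combination catalanGF_eq
  let S : ℤ → PowerSeries ℚ := fun h => u * (motzkinPathGF h).subst u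
  let D : ℤ → PowerSeries ℚ := fun h => X * pathPermsGF h
  have hS : ∀ h, 0 ≤ h → S h = u * ((if h = 0 then 1 else 0) + (S (h - 1) + S h + S (h + 1))) := by
    intro h hh
    have h1 := congrArg (substAlgHom (R := ℚ) hs) (motzkinPathGF_eq hh)
    rw [map_add, map_mul, map_add, map_add, substAlgHom_X] at h1
    have h2 : substAlgHom (R := ℚ) hs (if h = 0 then 1 else 0) = if h = 0 then 1 else 0 := by
      split_ifs <;> simp
    rw [h2] at h1
    simp only [coe_substAlgHom] at h1
    simp only [S]
    linear_combination u * h1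
  have hD : ∀ h, 0 ≤ h → D h = u * ((if h = 0 then 1 else 0) + (D (h - 1) + D h + D (h + 1))) := by
    intro h hh
    have h1 := pathPermsGF_eq hh
    have h3 : catalanGF * D h = u * ((if h = 0 then 1 else 0) +
        (D (h - 1) + 2 * D h + D (h + 1))) := by
      simp only [D]
      nth_rewrite 1 [h1]
      rw [hu2]
      ring
    -- Since `c = 1 + u`, moving `u * D h` to the right cancels one of the two flat steps; what
    -- remains is the Motzkin recursion.
    have h4 : catalanGF * D h = D h + u * D h := by rw [hc]; ring
    linear_combination h3 - h4
  -- The induction on the degree has to treat all heights at once, because the system couples `h` to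
  -- `h - 1` and `h + 1`.
  have hzero : ∀ n h, coeff n (D h - S h) = 0 := by
    intro n
    induction n using Nat.strong_induction_on with
    | _ n ih =>
      intro h
      rcases lt_or_ge h 0 with hh | hh
      · simp only [D, S, pathPermsGF_of_neg hh, motzkinPathGF_of_neg hh]
        rw [← coe_substAlgHom hs]
        simp
      · have e : D h - S h = u * ((D (h - 1) - S (h - 1)) + (D h - S h) +
            (D (h + 1) - S (h + 1))) := by
          linear_combination hD h hh - hS h hh
        rw [e, coeff_mul]
        refine Finset.sum_eq_zero fun p hp => ?_
        rw [Finset.HasAntidiagonal.mem_antidiagonal] at hp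
        rcases Nat.eq_zero_or_pos p.1 with h0 | h0
        · rw [h0, coeff_zero_eq_constantCoeff_apply, constantCoeff_catalanGF_sub_one, zero_mul]
        · rw [map_add, map_add, ih _ (by omega), ih _ (by omega), ih _ (by omega)]
          simp
  have : D 0 - S 0 = 0 := by
    ext n
    rw [hzero, map_zero]
  simp only [D, S, motzkinPathGF_zero] at this
  rw [seriesA]
  exact (sub_eq_zero.1 this).symm

/-! ### Ballot sequences as words of bit pairs -/

/-- The least `a` whose count reaches `c`. A count grows by at most 1 per step, so it hits `c`
exactly, and minimality makes the step before `a` a counted one. -/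
theorem exists_count_eq (p : ℕ → Prop) [DecidablePred p] {b c : ℕ} (h : c ≤ Nat.count p b) :
    ∃ a ≤ b, Nat.count p a = c ∧ (∀ a', c ≤ Nat.count p a' → a ≤ a') ∧ (0 < a → p (a - 1)) := by
  have hex : ∃ a, c ≤ Nat.count p a := ⟨b, h⟩
  have h1 := Nat.find_spec hex
  have key : Nat.count p (Nat.find hex) = c ∧ (0 < Nat.find hex → p (Nat.find hex - 1)) := by
    rcases hz : Nat.find hex with _ | a
    · rw [hz, Nat.count_zero] at h1
      simp
      omega
    · have h2 := Nat.find_min hex (m := a) (by omega)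
      rw [hz, Nat.count_succ] at h1
      rw [Nat.count_succ]
      split_ifs at h1 ⊢ with hp
      · exact ⟨by omega, fun _ => by simpa using hp⟩
      · omega
  exact ⟨Nat.find hex, Nat.find_min' hex h, key.1, fun a' ha' => Nat.find_min' hex ha', key.2⟩

theorem count_eq_of_forall_not (p : ℕ → Prop) [DecidablePred p] {a b : ℕ} (hab : a ≤ b)
    (h : ∀ v, a ≤ v → v < b → ¬ p v) : Nat.count p b = Nat.count p a := by
  induction b, hab using Nat.le_induction with
  | base => rfl
  | succ b hb ih =>
    rw [Nat.count_succ, if_neg (h b hb (by omega)), ih fun v h1 h2 => h v h1 (by omega), add_zero]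

/-- The positions where the first bit of a word is set. -/
def firstBit {n : ℕ} (w : Fin n → Bool × Bool) (j : ℕ) : Prop := ∃ hj : j < n, (w ⟨j, hj⟩).1 = true

/-- The positions where the second bit of a word is set. -/
def secondBit {n : ℕ} (w : Fin n → Bool × Bool) (j : ℕ) : Prop :=
  ∃ hj : j < n, (w ⟨j, hj⟩).2 = true

open Classical in
theorem sum_bitWeight {n : ℕ} (w : Fin n → Bool × Bool) (k : ℕ) :
    ∑ i : Fin n with i.val < k, bitWeight (w i) =
      (Nat.count (secondBit w) k : ℤ) - Nat.count (firstBit w) k := by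
  induction k with
  | zero => simp
  | succ k ih =>
    rw [Nat.count_succ, Nat.count_succ]
    by_cases hk : k < n
    · have : (Finset.univ.filter fun i : Fin n => i.val < k + 1) =
          insert ⟨k, hk⟩ (Finset.univ.filter fun i : Fin n => i.val < k) := by
        ext i
        simp only [Finset.mem_filter, Finset.mem_univ, true_and, Finset.mem_insert, Fin.ext_iff]
        omega
      rw [this, Finset.sum_insert (by simp), ih]
      have e1 : firstBit w k ↔ (w ⟨k, hk⟩).1 = true := ⟨fun h => h.2, fun h => ⟨hk, h⟩⟩
      have e2 : secondBit w k ↔ (w ⟨k, hk⟩).2 = true := ⟨fun h => h.2, fun h => ⟨hk, h⟩⟩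
      simp only [e1, e2, bitWeight]
      push_cast
      ring
    · have : (Finset.univ.filter fun i : Fin n => i.val < k + 1) =
          (Finset.univ.filter fun i : Fin n => i.val < k) := by
        ext i
        simp only [Finset.mem_filter, Finset.mem_univ, true_and]
        omega
      rw [this, ih, if_neg fun h => hk h.1, if_neg fun h => hk h.1]
      simp

open Classical in
theorem mem_paths_bitWeight {n : ℕ} (w : Fin n → Bool × Bool) : w ∈ paths bitWeight 0 n ↔
    (∀ k ≤ n, Nat.count (firstBit w) k ≤ Nat.count (secondBit w) k) ∧
      Nat.count (firstBit w) n = Nat.count (secondBit w) n := by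
  have ht : ∑ i, bitWeight (w i) =
      (Nat.count (secondBit w) n : ℤ) - Nat.count (firstBit w) n := by
    rw [← sum_bitWeight]
    simp
  have hn : ∀ k, n ≤ k → Nat.count (firstBit w) k = Nat.count (firstBit w) n ∧
      Nat.count (secondBit w) k = Nat.count (secondBit w) n := fun k hk =>
    ⟨count_eq_of_forall_not _ hk fun v h1 _ h3 => by have := h3.1; omega,
      count_eq_of_forall_not _ hk fun v h1 _ h3 => by have := h3.1; omega⟩
  rw [mem_paths, ht]
  simp only [sum_bitWeight]
  constructor
  · rintro ⟨h1, h2⟩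
    refine ⟨fun k _ => ?_, by omega⟩
    have := h1 k
    omega
  · rintro ⟨h1, h2⟩
    refine ⟨fun k => ?_, by omega⟩
    rcases le_total k n with hk | hk
    · have := h1 k hk
      omega
    · obtain ⟨e1, e2⟩ := hn k hk
      omega

open Classical in
/-- The monotone sequences below the diagonal. -/
noncomputable def ballot (n : ℕ) : Finset (Fin n → Fin n) :=
  Finset.univ.filter fun α => Monotone α ∧ ∀ k, α k ≤ k

theorem mem_ballot {n : ℕ} {α : Fin n → Fin n} : α ∈ ballot n ↔ Monotone α ∧ ∀ k, α k ≤ k := by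
  simp [ballot]

/-- The sequence `α` is constant between `j` and `j + 1`, and does not take the value `j + 1`. -/
def joinedAt {n : ℕ} (α : Fin n → Fin n) (j : ℕ) : Prop :=
  ∃ hj : j + 1 < n, α ⟨j + 1, hj⟩ = α ⟨j, by omega⟩ ∧ ∀ i, (α i).val ≠ j + 1

open Classical in
/-- The word that records the jumps and the values of a sequence. -/
noncomputable def ballotWord {n : ℕ} (α : Fin (n + 1) → Fin (n + 1)) (k : Fin n) : Bool × Bool :=
  (decide (α k.succ ≠ α k.castSucc), decide (∃ i, (α i).val = k.val + 1))

theorem flatAt_ballotWord {n : ℕ} (α : Fin (n + 1) → Fin (n + 1)) (j : ℕ) :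
    flatAt (ballotWord α) j ↔ joinedAt α j := by
  constructor
  · rintro ⟨hj, h⟩
    simp only [ballotWord, Prod.mk.injEq, decide_eq_false_iff_not, not_not, not_exists] at h
    exact ⟨by omega, h.1, h.2⟩
  · rintro ⟨hj, h1, h2⟩
    refine ⟨by omega, ?_⟩
    simp only [ballotWord, Prod.mk.injEq, decide_eq_false_iff_not, not_not, not_exists]
    exact ⟨h1, h2⟩

theorem firstBit_ballotWord {n : ℕ} (α : Fin (n + 1) → Fin (n + 1)) {j : ℕ} (hj : j < n) :
    firstBit (ballotWord α) j ↔ α ⟨j + 1, by omega⟩ ≠ α ⟨j, by omega⟩ := by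
  constructor
  · rintro ⟨hj, h⟩
    simp only [ballotWord, decide_eq_true_eq] at h
    exact h
  · intro h
    refine ⟨hj, ?_⟩
    simp only [ballotWord, decide_eq_true_eq]
    exact h

theorem secondBit_ballotWord {n : ℕ} (α : Fin (n + 1) → Fin (n + 1)) (j : ℕ) :
    secondBit (ballotWord α) j ↔ ∃ i, (α i).val = j + 1 := by
  constructor
  · rintro ⟨hj, h⟩
    simpa only [ballotWord, decide_eq_true_eq] using h
  · rintro ⟨i, h⟩
    refine ⟨by omega, ?_⟩
    simp only [ballotWord, decide_eq_true_eq]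
    exact ⟨i, h⟩

-- Each jump of `α` before `k` produces one new positive value, so both sides count the positive
-- values taken up to position `k`. This links the two bits, and `α k ≤ k` becomes nonnegativity of
-- the path.
open Classical in
theorem count_ballotWord {n : ℕ} {α : Fin (n + 1) → Fin (n + 1)} (hα : α ∈ ballot (n + 1))
    (k : ℕ) (hk : k < n + 1) : Nat.count (firstBit (ballotWord α)) k =
      Nat.count (secondBit (ballotWord α)) (α ⟨k, hk⟩).val := by
  obtain ⟨hm, hd⟩ := mem_ballot.1 hα
  induction k with
  | zero =>
    have : (α ⟨0, hk⟩).val = 0 := by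
      have := hd ⟨0, hk⟩
      rw [Fin.le_def] at this
      simpa using this
    rw [this]
    simp
  | succ k ih =>
    rw [Nat.count_succ, ih (by omega)]
    have hle : α ⟨k, by omega⟩ ≤ α ⟨k + 1, hk⟩ := hm (by rw [Fin.le_def]; simp)
    split_ifs with hS
    · rw [firstBit_ballotWord α (by omega)] at hS
      obtain ⟨b, hb⟩ : ∃ b, (α ⟨k + 1, hk⟩).val = b + 1 := ⟨(α ⟨k + 1, hk⟩).val - 1, by omega⟩
      rw [hb, Nat.count_succ, if_pos ((secondBit_ballotWord α b).2 ⟨_, hb⟩),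
        count_eq_of_forall_not _ (a := (α ⟨k, by omega⟩).val) (b := b) (by omega)]
      intro v h1 h2 h3
      obtain ⟨i, hi⟩ := (secondBit_ballotWord α v).1 h3
      rcases Nat.lt_or_ge i.val (k + 1) with hik | hik
      · have := hm (show i ≤ ⟨k, by omega⟩ from by rw [Fin.le_def]; simp; omega)
        rw [Fin.le_def] at this
        omega
      · have := hm (show ⟨k + 1, hk⟩ ≤ i from hik)
        rw [Fin.le_def] at this
        omega
    · rw [firstBit_ballotWord α (by omega), not_not] at hS
      rw [hS, add_zero]

open Classical in
theorem ballotWord_mem_paths {n : ℕ} {α : Fin (n + 1) → Fin (n + 1)} (hα : α ∈ ballot (n + 1)) :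
    ballotWord α ∈ paths bitWeight 0 n := by
  obtain ⟨hm, hd⟩ := mem_ballot.1 hα
  rw [mem_paths_bitWeight]
  constructor
  · intro k hk
    rw [count_ballotWord hα k (by omega)]
    exact Nat.count_monotone _ (hd ⟨k, by omega⟩)
  · rw [count_ballotWord hα n (by omega), eq_comm]
    refine count_eq_of_forall_not _ (hd ⟨n, by omega⟩) fun v h1 h2 h3 => ?_
    obtain ⟨i, hi⟩ := (secondBit_ballotWord α v).1 h3
    have := hm (show i ≤ ⟨n, by omega⟩ from Fin.le_last i)
    rw [Fin.le_def] at this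
    omega

-- The bit just below a positive value of `α` is set, so `α k` is the least argument at which the
-- count of second bits reaches the number of jumps before `k`. The word therefore determines `α`.
open Classical in
theorem le_of_ballotWord_eq {n : ℕ} {α β : Fin (n + 1) → Fin (n + 1)} (hα : α ∈ ballot (n + 1))
    (hβ : β ∈ ballot (n + 1)) (h : ballotWord α = ballotWord β) (k : Fin (n + 1)) :
    α k ≤ β k := by
  by_contra hc
  have h1 := count_ballotWord hα k.val k.isLt
  have h2 := count_ballotWord hβ k.val k.isLt
  rw [← h, h1] at h2
  obtain ⟨b, hb⟩ : ∃ b, (α k).val = b + 1 := ⟨(α k).val - 1, by omega⟩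
  simp only [Fin.eta] at h2
  rw [hb, Nat.count_succ, if_pos ((secondBit_ballotWord α b).2 ⟨_, hb⟩)] at h2
  have := Nat.count_monotone (secondBit (ballotWord α)) (show (β k).val ≤ b by omega)
  omega

-- The sequence is recovered as the least `f k` at which the count of second bits equals the count
-- of first bits before `k`. Nonnegativity of the path gives `f k ≤ k`, and its end at height 0
-- ensures that every set second bit comes from a value.
open Classical in
theorem exists_ballotWord {n : ℕ} {w : Fin n → Bool × Bool} (hw : w ∈ paths bitWeight 0 n) :
    ∃ α ∈ ballot (n + 1), ballotWord α = w := by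
  rw [mem_paths_bitWeight] at hw
  obtain ⟨h1, h2⟩ := hw
  have hex := fun k : Fin (n + 1) => exists_count_eq (secondBit w) (h1 k.val (by omega))
  choose f hf1 hf2 hf3 hf4 using hex
  have hmono : ∀ k l : Fin (n + 1), k ≤ l → f k ≤ f l := fun k l hkl =>
    hf3 k _ (by rw [hf2]; exact Nat.count_monotone _ hkl)
  have hα : (fun k => (⟨f k, by have := hf1 k; omega⟩ : Fin (n + 1))) ∈ ballot (n + 1) :=
    mem_ballot.2 ⟨hmono, hf1⟩
  refine ⟨_, hα, ?_⟩
  funext k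
  have hS : (w k).1 = true ↔ firstBit w k.val := ⟨fun h => ⟨k.isLt, h⟩, fun h => h.2⟩
  have hT : (w k).2 = true ↔ secondBit w k.val := ⟨fun h => ⟨k.isLt, h⟩, fun h => h.2⟩
  refine Prod.ext ?_ ?_
  · rw [Bool.eq_iff_iff, hS]
    simp only [ballotWord, decide_eq_true_eq, ne_eq, Fin.mk.injEq]
    have hc : Nat.count (firstBit w) (k.val + 1) = _ := Nat.count_succ _ _
    have e1 := hf2 k.succ
    have e2 := hf2 k.castSucc
    rw [Fin.val_succ] at e1
    rw [Fin.val_castSucc] at e2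
    constructor
    · intro hne
      by_contra hn
      rw [if_neg hn, add_zero] at hc
      refine hne (le_antisymm (hf3 _ _ ?_) (hf3 _ _ ?_))
      · rw [e2, Fin.val_succ, hc]
      · rw [e1, Fin.val_castSucc, hc]
    · intro hp he
      rw [if_pos hp] at hc
      rw [he] at e1
      omega
  · rw [Bool.eq_iff_iff, hT]
    simp only [ballotWord, decide_eq_true_eq]
    constructor
    · rintro ⟨i, hi⟩
      have := hf4 i (by omega)
      rwa [hi, Nat.add_sub_cancel] at this
    · intro hp
      have hc : Nat.count (secondBit w) (k.val + 1) = _ := Nat.count_succ _ _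
      rw [if_pos hp] at hc
      have hle := Nat.count_monotone (secondBit w) (show k.val + 1 ≤ n by omega)
      rw [← h2] at hle
      obtain ⟨i, hi, hci, -, -⟩ := exists_count_eq (firstBit w) hle
      refine ⟨⟨i, by omega⟩, le_antisymm (hf3 _ _ (by simp only; omega)) ?_⟩
      by_contra hlt
      have e := hf2 ⟨i, by omega⟩
      have := Nat.count_monotone (secondBit w)
        (show f ⟨i, by omega⟩ ≤ k.val by omega)
      simp only at e
      omega

theorem sum_ballot (n : ℕ) : ∑ α ∈ ballot (n + 1), (avJoined (n + 1) (joinedAt α)).ncard =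
    pathPerms 0 n := by
  refine Finset.sum_nbij ballotWord (fun α hα => ballotWord_mem_paths hα) ?_ ?_ ?_
  · intro α hα β hβ h
    funext k
    exact le_antisymm (le_of_ballotWord_eq hα hβ h k) (le_of_ballotWord_eq hβ hα h.symm k)
  · intro w hw
    obtain ⟨α, hα, rfl⟩ := exists_ballotWord hw
    exact ⟨α, hα, rfl⟩
  · intro α _
    rw [avJoined_congr fun j _ => flatAt_ballotWord α j]

/-! ### Coding permutations with 312 cycles -/

/-- The sequence conjugate to `α`. -/
def conjSeq {n : ℕ} (α : Fin n → Fin n) (k : Fin n) : ℕ := (Finset.univ.filter fun j => α j ≤ k).card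

theorem lt_conjSeq {n : ℕ} {α : Fin n → Fin n} (hα : Monotone α) {j k : Fin n} :
    j.val < conjSeq α k ↔ α j ≤ k :=
  Tuple.lt_card_le_iff_apply_le_of_monotone hα

theorem conjSeq_le {n : ℕ} (α : Fin n → Fin n) (k : Fin n) : conjSeq α k ≤ n := by
  refine (Finset.card_le_univ _).trans ?_
  simp

theorem conjSeq_mono {n : ℕ} (α : Fin n → Fin n) {j k : Fin n} (h : j ≤ k) :
    conjSeq α j ≤ conjSeq α k := by
  refine Finset.card_le_card fun i hi => ?_
  simp only [Finset.mem_filter, Finset.mem_univ, true_and] at hi ⊢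
  exact hi.trans h

/-- The position of a smallest element of a cycle. -/
def posP {n : ℕ} (i : Fin n) : Fin (3 * n) := ⟨i.val, by omega⟩

/-- The position of a middle element of a cycle, in the permutation coded by `α`. -/
def posQ {n : ℕ} (α : Fin n → Fin n) (k : Fin n) : Fin (3 * n) :=
  ⟨n + k.val + (α k).val, by omega⟩

/-- The position of a largest element of a cycle, in the permutation coded by `α`. -/
def posR {n : ℕ} (α : Fin n → Fin n) (k : Fin n) : Fin (3 * n) :=
  ⟨n + k.val + conjSeq α k, by have := conjSeq_le α k; omega⟩

theorem posP_injective (n : ℕ) : Function.Injective (posP (n := n)) := by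
  intro i j h
  simpa [posP, Fin.ext_iff] using h

section order

variable {n : ℕ} {α : Fin n → Fin n}

theorem posP_lt_posP {i j : Fin n} : posP i < posP j ↔ i < j := Iff.rfl

theorem posP_lt_posQ (i k : Fin n) : posP i < posQ α k := by
  rw [Fin.lt_def]
  simp only [posP, posQ]
  omega

theorem posP_lt_posR (i k : Fin n) : posP i < posR α k := by
  rw [Fin.lt_def]
  simp only [posP, posR]
  omega

theorem posQ_strictMono (hα : Monotone α) : StrictMono (posQ α) := by
  intro j k hjk
  have := hα hjk.le
  rw [Fin.lt_def]
  simp only [posQ]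
  omega

theorem posR_strictMono (α : Fin n → Fin n) : StrictMono (posR α) := by
  intro j k hjk
  have := conjSeq_mono α hjk.le
  rw [Fin.lt_def]
  simp only [posR]
  omega

theorem posQ_lt_posR (hα : Monotone α) {j k : Fin n} : posQ α j < posR α k ↔ α j ≤ k := by
  have := lt_conjSeq hα (j := j) (k := k)
  rw [Fin.lt_def]
  simp only [posQ, posR]
  rw [← this]
  by_cases h : α j ≤ k
  · have := this.2 h
    constructor
    · omega
    · omega
  · have h' := mt this.1 h
    constructor
    · omega
    · omega

theorem posR_lt_posQ (hα : Monotone α) {j k : Fin n} : posR α k < posQ α j ↔ k < α j := by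
  have := lt_conjSeq hα (j := j) (k := k)
  rw [Fin.lt_def]
  simp only [posQ, posR]
  by_cases h : α j ≤ k
  · have := this.2 h
    constructor
    · omega
    · omega
  · have h' := mt this.1 h
    constructor
    · omega
    · omega

end order

/-- The three kinds of positions together. -/
def posFun {n : ℕ} (α : Fin n → Fin n) : Fin n ⊕ (Fin n ⊕ Fin n) → Fin (3 * n) :=
  Sum.elim posP (Sum.elim (posQ α) (posR α))

theorem posFun_bijective {n : ℕ} {α : Fin n → Fin n} (hα : Monotone α) :
    Function.Bijective (posFun α) := by
  rw [Fintype.bijective_iff_injective_and_card]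
  constructor
  · refine (posP_injective n).sumElim ((posQ_strictMono hα).injective.sumElim (posR_strictMono α).injective ?_) ?_
    · intro j k h
      have h1 := posQ_lt_posR hα (j := j) (k := k)
      have h2 := posR_lt_posQ hα (j := j) (k := k)
      rw [h] at h1 h2
      simp only [lt_irrefl, false_iff] at h1 h2
      omega
    · rintro i (k | k)
      · exact (posP_lt_posQ i k).ne
      · exact (posP_lt_posR i k).ne
  · simp
    omega

/-- The permutation of the three kinds of positions given by `τ`. -/
def basePerm {n : ℕ} (τ : Perm (Fin n)) : Perm (Fin n ⊕ (Fin n ⊕ Fin n)) where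
  toFun := Sum.elim (fun i => Sum.inr (Sum.inr (τ.symm i)))
    (Sum.elim (fun k => Sum.inl (τ k)) (fun k => Sum.inr (Sum.inl k)))
  invFun := Sum.elim (fun i => Sum.inr (Sum.inl (τ.symm i)))
    (Sum.elim (fun k => Sum.inr (Sum.inr k)) (fun k => Sum.inl (τ k)))
  left_inv := by rintro (i | k | k) <;> simp
  right_inv := by rintro (i | k | k) <;> simp

/-- The permutation with `312` cycles coded by `α` and `τ`. -/
noncomputable def build {n : ℕ} (α : ballot n) (τ : Perm (Fin n)) : Perm (Fin (3 * n)) :=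
  (Equiv.ofBijective _ (posFun_bijective (mem_ballot.1 α.2).1)).permCongr (basePerm τ)

section build

variable {n : ℕ} (α : ballot n) (τ : Perm (Fin n))

theorem build_posFun (z : Fin n ⊕ (Fin n ⊕ Fin n)) :
    build α τ (posFun α.1 z) = posFun α.1 (basePerm τ z) := by
  have : posFun α.1 z =
      (Equiv.ofBijective _ (posFun_bijective (mem_ballot.1 α.2).1)) z := rfl
  rw [this, build, Equiv.permCongr_apply, Equiv.symm_apply_apply]
  rfl

@[simp]
theorem build_posP (k : Fin n) : build α τ (posP (τ k)) = posR α.1 k := by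
  have := build_posFun α τ (Sum.inl (τ k))
  simpa [posFun, basePerm] using this

@[simp]
theorem build_posQ (k : Fin n) : build α τ (posQ α.1 k) = posP (τ k) :=
  build_posFun α τ (Sum.inr (Sum.inl k))

@[simp]
theorem build_posR (k : Fin n) : build α τ (posR α.1 k) = posQ α.1 k :=
  build_posFun α τ (Sum.inr (Sum.inr k))

theorem pos_cases (y : Fin (3 * n)) :
    (∃ k, y = posP (τ k)) ∨ (∃ k, y = posQ α.1 k) ∨ ∃ k, y = posR α.1 k := by
  obtain ⟨z | z | z, rfl⟩ := (posFun_bijective (mem_ballot.1 α.2).1).surjective y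
  · exact Or.inl ⟨τ.symm z, by simp [posFun]⟩
  · exact Or.inr (Or.inl ⟨z, rfl⟩)
  · exact Or.inr (Or.inr ⟨z, rfl⟩)

theorem isThree_build : IsThree (build α τ) := by
  intro y
  rcases pos_cases α τ y with ⟨k, rfl⟩ | ⟨k, rfl⟩ | ⟨k, rfl⟩
  · simp only [build_posP, build_posR, build_posQ, and_true]
    exact (posP_lt_posR _ _).ne'
  · simp only [build_posP, build_posR, build_posQ, and_true]
    exact (posP_lt_posQ _ _).ne
  · simp only [build_posP, build_posR, build_posQ, and_true]
    exact ((posQ_lt_posR (mem_ballot.1 α.2).1).2 ((mem_ballot.1 α.2).2 k)).ne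

theorem no231Cycle_build : No231Cycle (build α τ) := by
  intro y h1 h2
  rcases pos_cases α τ y with ⟨k, rfl⟩ | ⟨k, rfl⟩ | ⟨k, rfl⟩
  · simp only [build_posP, build_posR] at h2
    exact h2.asymm ((posQ_lt_posR (mem_ballot.1 α.2).1).2 ((mem_ballot.1 α.2).2 k))
  · rw [build_posQ] at h1
    exact h1.asymm (posP_lt_posQ _ _)
  · rw [build_posR] at h1
    exact h1.asymm ((posQ_lt_posR (mem_ballot.1 α.2).1).2 ((mem_ballot.1 α.2).2 k))

theorem eq_of_joinedAt {β : Fin n → Fin n} {k l : Fin n} (hkl : k ≤ l)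
    (h : ∀ j : ℕ, k.val ≤ j → j < l.val → joinedAt β j) : β l = β k := by
  obtain ⟨k, hk⟩ := k
  obtain ⟨l, hl⟩ := l
  replace hkl : k ≤ l := hkl
  induction l, hkl using Nat.le_induction with
  | base => rfl
  | succ l hkl ih =>
    obtain ⟨_, e, -⟩ := h l hkl (Nat.lt_succ_self l)
    rw [e]
    exact ih (by omega) fun j h1 h2 => h j h1 (h2.trans (Nat.lt_succ_self l))

/-- The mixed occurrences of 132 have two shapes. Positions middle, largest, middle violate
constancy of `α` along a non-inversion of `τ`; positions smallest, smallest, largest violate the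
omission of the values it spans. Three smallest or three middle positions reproduce a 132 in `τ`
itself. -/
theorem no132_build_iff : No132 (build α τ) ↔ τ ∈ avJoined n (joinedAt α.1) := by
  have hα := (mem_ballot.1 α.2).1
  have hQ := posQ_strictMono hα
  have hR := posR_strictMono α.1
  have nQP : ∀ i k, ¬ posQ α.1 k < posP i := fun i k => (posP_lt_posQ i k).asymm
  have nRP : ∀ i k, ¬ posR α.1 k < posP i := fun i k => (posP_lt_posR i k).asymm
  constructor
  · intro h
    refine ⟨?_, ?_⟩
    · intro a b c hab hbc h1 h2
      exact h (posQ α.1 a) (posQ α.1 b) (posQ α.1 c) (hQ hab) (hQ hbc)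
        (by simpa [posP_lt_posP] using h1) (by simpa [posP_lt_posP] using h2)
    · intro k l hkl hτ j hj1 hj2
      refine ⟨by omega, ?_, ?_⟩
      · by_contra hne
        have a0 := hα (show (⟨j, by omega⟩ : Fin n) ≤ ⟨j + 1, by omega⟩ by simp [Fin.le_def])
        have a1 := hα (show k ≤ ⟨j, by omega⟩ from hj1)
        have a2 := hα (show (⟨j + 1, by omega⟩ : Fin n) ≤ l from hj2)
        -- If `α` jumps between `k` and `l`, the largest position with index `α k` lies between the
        -- two middle ones and carries a larger value than both.
        refine h (posQ α.1 k) (posR α.1 (α.1 k)) (posQ α.1 l) ((posQ_lt_posR hα).2 le_rfl)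
          ((posR_lt_posQ hα).2 (by omega)) ?_ ?_
        · simpa [posP_lt_posP] using hτ
        · simpa using posP_lt_posQ _ _
      · intro i hi
        refine h (posP (τ k)) (posP (τ l)) (posR α.1 i) hτ (posP_lt_posR _ _) ?_ ?_
        · simp only [build_posP, build_posR]
          exact (posR_lt_posQ hα).2 (by omega)
        · simp only [build_posP, build_posR]
          exact (posQ_lt_posR hα).2 (by omega)
  · rintro ⟨h1, h2⟩ a b c hab hbc h3 h4
    rcases pos_cases α τ a with ⟨k, rfl⟩ | ⟨k, rfl⟩ | ⟨k, rfl⟩ <;>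
    rcases pos_cases α τ b with ⟨l, rfl⟩ | ⟨l, rfl⟩ | ⟨l, rfl⟩ <;>
    rcases pos_cases α τ c with ⟨m, rfl⟩ | ⟨m, rfl⟩ | ⟨m, rfl⟩ <;>
    simp only [build_posP, build_posQ, build_posR, posP_lt_posP, posP_lt_posQ, posP_lt_posR,
      posQ_lt_posR hα, posR_lt_posQ hα, hQ.lt_iff_lt, hR.lt_iff_lt, nQP, nRP] at hab hbc h3 h4
    · exact h1 k m l h3 h4 hab hbc
    -- Positions smallest, smallest, largest: here `k < α m ≤ l`, so the non-inversion spans the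
    -- step just below the value `α m`.
    · obtain ⟨j, hj⟩ : ∃ j, (α.1 m).val = j + 1 := ⟨(α.1 m).val - 1, by omega⟩
      obtain ⟨-, -, hn⟩ := h2 k l (by omega) hab j (by omega) (by omega)
      exact hn m hj
    · omega
    · exact h1 k l m hab hbc h3 h4
    -- Positions middle, largest, middle: here `α k ≤ l < α m`, although `α` is constant along the
    -- non-inversion from `k` to `m`.
    · have hQQ : k < m := by
        by_contra hc
        have := hα (not_lt.1 hc)
        omega
      have := eq_of_joinedAt hQQ.le (h2 k m hQQ h3)
      omega
    all_goals omega

theorem build_mem_setA_iff : build α τ ∈ setA n ↔ τ ∈ avJoined n (joinedAt α.1) := by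
  rw [mem_setA_iff, ← no132_build_iff]
  exact ⟨fun h => h.2.1, fun h => ⟨isThree_build α τ, h, no231Cycle_build α τ⟩⟩

/-- Describes the set of largest positions through the permutation alone, so that `build_injective`
can recover the code. -/
theorem range_posR : Set.range (posR α.1) =
    {y | n ≤ y.val ∧ n ≤ (build α τ y).val} := by
  ext y
  constructor
  · rintro ⟨k, rfl⟩
    refine ⟨?_, ?_⟩
    · simp only [posR]
      omega
    · rw [build_posR]
      simp only [posQ]
      omega
  · rintro ⟨h1, h2⟩
    rcases pos_cases α τ y with ⟨k, rfl⟩ | ⟨k, rfl⟩ | ⟨k, rfl⟩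
    · simp only [posP] at h1
      omega
    · rw [build_posQ] at h2
      simp only [posP] at h2
      omega
    · exact ⟨k, rfl⟩

end build

theorem build_injective (n : ℕ) :
    Function.Injective (fun z : ballot n × Perm (Fin n) => build z.1 z.2) := by
  rintro ⟨α, τ⟩ ⟨β, σ⟩ h
  simp only at h
  have hR : posR α.1 = posR β.1 := by
    rw [← (posR_strictMono α.1).range_inj (posR_strictMono β.1), range_posR α τ, range_posR β σ, h]
  have hQ : ∀ k, posQ α.1 k = posQ β.1 k := by
    intro k
    rw [← build_posR α τ, ← build_posR β σ, h, hR]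
  have hP : ∀ k, posP (τ k) = posP (σ k) := by
    intro k
    rw [← build_posQ α τ, ← build_posQ β σ, h, hQ]
  refine Prod.ext (Subtype.ext (funext fun k => ?_)) (Equiv.ext fun k => ?_)
  · have := congrArg Fin.val (hQ k)
    simp only [posQ] at this
    exact Fin.ext (by simpa using this)
  · exact posP_injective n (hP k)

/-- Because 132 is avoided and all cycles are 312, the middle elements increase together with the
largest ones. Counting what lies below each of them identifies its position with the one prescribed
by the code. -/
theorem exists_build {n : ℕ} {π : Perm (Fin (3 * n))} (hπ : π ∈ setA n) :
    ∃ α τ, build α τ = π := by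
  obtain ⟨h, h132, hA⟩ := (mem_setA_iff π).1 hπ
  -- Cycles are indexed by increasing largest element, and `τ` reads off the smallest elements in
  -- that order.
  let τ : Perm (Fin n) := Tuple.sort fun i => π (posP i)
  let r : Fin n → Fin (3 * n) := fun k => π (posP (τ k))
  let q : Fin n → Fin (3 * n) := fun k => π (r k)
  have hlt : ∀ i : Fin n, (posP i).val < n := fun i => i.isLt
  have hrn : ∀ k, n ≤ (r k).val := fun k => (h.le_apply h132 (hlt (τ k))).1
  have hqn : ∀ k, n ≤ (q k).val := fun k => (h.le_apply h132 (hlt (τ k))).2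
  have hπq : ∀ k, π (q k) = posP (τ k) := fun k => (h _).2
  have hrm : StrictMono r := (Tuple.monotone_sort fun i => π (posP i)).strictMono_of_injective
    (π.injective.comp ((posP_injective n).comp τ.injective))
  have hqm : StrictMono q := by
    intro j k hjk
    rcases lt_trichotomy (q j) (q k) with hq | hq | hq
    · exact hq
    · exact absurd (hrm.injective (π.injective hq)) hjk.ne
    · exact (hA.increasing h h132 (hrn j) (hrm hjk) (hqn k) hq).elim
  have hqr : ∀ k, q k < r k := by
    intro k
    have hm := (isMin_iff_lt h h132 _).2 (hlt (τ k))
    have h1 : ¬ r k < q k := fun h2 => hA _ hm.1 h2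
    have h2 : q k ≠ r k := (h (r k)).1
    omega
  have hne : ∀ j k, q j ≠ r k := by
    intro j k e
    have : r j = posP (τ k) := π.injective e
    have h1 := hrn j
    rw [this] at h1
    have := hlt (τ k)
    omega
  have hcov : ∀ y : Fin (3 * n), (∃ i, posP i = y) ∨ (∃ k, q k = y) ∨ ∃ k, r k = y := by
    intro y
    obtain ⟨i, hi, hy⟩ := h.exists_lt h132 y
    have hi' : i = posP (τ (τ.symm ⟨i.val, hi⟩)) := by
      rw [Equiv.apply_symm_apply]
      rfl
    rcases hy with rfl | rfl | rfl
    · exact Or.inl ⟨⟨_, hi⟩, rfl⟩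
    · exact Or.inr (Or.inr ⟨τ.symm ⟨i.val, hi⟩, congrArg π hi'.symm⟩)
    · exact Or.inr (Or.inl ⟨τ.symm ⟨i.val, hi⟩, congrArg (fun z => π (π z)) hi'.symm⟩)
  -- The number of largest elements below the `k`-th middle one. It is at most `k` because `q k < r
  -- k`.
  let a : Fin n → ℕ := fun k => (Finset.univ.filter fun j => r j < q k).card
  have ha : ∀ j k, j.val < a k ↔ r j < q k := fun j k =>
    Tuple.lt_card_lt_iff_apply_lt_of_monotone hrm.monotone
  have hak : ∀ k, a k ≤ k.val := by
    intro k
    by_contra hc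
    exact ((ha k k).1 (by omega)).asymm (hqr k)
  let α : Fin n → Fin n := fun k => ⟨a k, (hak k).trans_lt k.isLt⟩
  have hα : α ∈ ballot n := by
    refine mem_ballot.2 ⟨fun j k hjk => ?_, hak⟩
    change a j ≤ a k
    refine Finset.card_le_card fun i hi => ?_
    simp only [Finset.mem_filter, Finset.mem_univ, true_and] at hi ⊢
    exact hi.trans_le (hqm.monotone hjk)
  have cardP : (Finset.univ.image (posP (n := n))).card = n := by
    rw [Finset.card_image_of_injective _ (posP_injective n)]
    simp
  have hQ : ∀ k, posQ α k = q k := by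
    intro k
    have e : Finset.Iio (q k) = Finset.univ.image posP ∪ ((Finset.Iio k).image q ∪
        (Finset.univ.filter fun j => r j < q k).image r) := by
      ext y
      simp only [Finset.mem_Iio, Finset.mem_union, Finset.mem_image, Finset.mem_univ, true_and,
        Finset.mem_filter]
      constructor
      · intro hy
        rcases hcov y with hc | ⟨j, rfl⟩ | ⟨j, rfl⟩
        · exact Or.inl hc
        · exact Or.inr (Or.inl ⟨j, hqm.lt_iff_lt.1 hy, rfl⟩)
        · exact Or.inr (Or.inr ⟨j, hy, rfl⟩)
      · rintro (⟨i, rfl⟩ | ⟨j, hj, rfl⟩ | ⟨j, hj, rfl⟩)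
        · exact (hlt i).trans_le (hqn k)
        · exact hqm hj
        · exact hj
    have hc := congrArg Finset.card e
    rw [Fin.card_Iio, Finset.card_union_of_disjoint, Finset.card_union_of_disjoint, cardP,
      Finset.card_image_of_injective _ hqm.injective,
      Finset.card_image_of_injective _ hrm.injective, Fin.card_Iio] at hc
    · apply Fin.ext
      rw [hc, ← add_assoc]
      rfl
    · rw [Finset.disjoint_left]
      simp only [Finset.mem_image]
      rintro _ ⟨j, -, rfl⟩ ⟨i, -, e⟩
      exact hne j i e.symm
    · rw [Finset.disjoint_left]
      simp only [Finset.mem_image, Finset.mem_union]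
      rintro _ ⟨i, -, rfl⟩ (⟨j, -, e⟩ | ⟨j, -, e⟩)
      · have := hqn j
        rw [e] at this
        exact absurd (hlt i) (by omega)
      · have := hrn j
        rw [e] at this
        exact absurd (hlt i) (by omega)
  have hR : ∀ k, posR α k = r k := by
    intro k
    have hβ : ∀ j, α j ≤ k ↔ q j < r k := by
      intro j
      have h1 := ha k j
      have h2 := hne j k
      rw [Fin.le_def]
      change a j ≤ k.val ↔ _
      by_cases h3 : r k < q j
      · have := h1.2 h3
        constructor <;> omega
      · have := mt h1.1 h3
        constructor <;> omega
    have e : Finset.Iio (r k) = Finset.univ.image posP ∪ ((Finset.Iio k).image r ∪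
        (Finset.univ.filter fun j => α j ≤ k).image q) := by
      ext y
      simp only [Finset.mem_Iio, Finset.mem_union, Finset.mem_image, Finset.mem_univ, true_and,
        Finset.mem_filter]
      constructor
      · intro hy
        rcases hcov y with hc | ⟨j, rfl⟩ | ⟨j, rfl⟩
        · exact Or.inl hc
        · exact Or.inr (Or.inr ⟨j, (hβ j).2 hy, rfl⟩)
        · exact Or.inr (Or.inl ⟨j, hrm.lt_iff_lt.1 hy, rfl⟩)
      · rintro (⟨i, rfl⟩ | ⟨j, hj, rfl⟩ | ⟨j, hj, rfl⟩)
        · exact (hlt i).trans_le (hrn k)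
        · exact hrm hj
        · exact (hβ j).1 hj
    have hc := congrArg Finset.card e
    rw [Fin.card_Iio, Finset.card_union_of_disjoint, Finset.card_union_of_disjoint, cardP,
      Finset.card_image_of_injective _ hqm.injective,
      Finset.card_image_of_injective _ hrm.injective, Fin.card_Iio] at hc
    · apply Fin.ext
      rw [hc, ← add_assoc]
      rfl
    · rw [Finset.disjoint_left]
      simp only [Finset.mem_image]
      rintro _ ⟨j, -, rfl⟩ ⟨i, -, e⟩
      exact hne i j e
    · rw [Finset.disjoint_left]
      simp only [Finset.mem_image, Finset.mem_union]
      rintro _ ⟨i, -, rfl⟩ (⟨j, -, e⟩ | ⟨j, -, e⟩)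
      · have := hrn j
        rw [e] at this
        exact absurd (hlt i) (by omega)
      · have := hqn j
        rw [e] at this
        exact absurd (hlt i) (by omega)
  refine ⟨⟨α, hα⟩, τ, Equiv.ext fun y => ?_⟩
  rcases pos_cases ⟨α, hα⟩ τ y with ⟨k, rfl⟩ | ⟨k, rfl⟩ | ⟨k, rfl⟩
  · rw [build_posP]
    exact hR k
  · rw [build_posQ]
    simp only [hQ]
    exact (hπq k).symm
  · rw [build_posR]
    simp only [hQ, hR]
    rfl

theorem ncard_setA (n : ℕ) :
    (setA n).ncard = ∑ α ∈ ballot n, (avJoined n (joinedAt α)).ncard := by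
  classical
  have e : setA n = (fun z : ballot n × Perm (Fin n) => build z.1 z.2) ''
      {z | z.2 ∈ avJoined n (joinedAt z.1.1)} := by
    ext π
    constructor
    · intro hπ
      obtain ⟨α, τ, rfl⟩ := exists_build hπ
      exact ⟨(α, τ), (build_mem_setA_iff α τ).1 hπ, rfl⟩
    · rintro ⟨⟨α, τ⟩, h, rfl⟩
      exact (build_mem_setA_iff α τ).2 h
  rw [e, Set.ncard_image_of_injective _ (build_injective n), Set.ncard_eq_toFinset_card',
    Finset.card_eq_sum_card_fiberwise (f := Prod.fst) (t := Finset.univ) (by simp),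
    ← Finset.sum_coe_sort (ballot n) fun α => (avJoined n (joinedAt α)).ncard]
  refine Finset.sum_congr rfl fun α _ => ?_
  rw [← Set.ncard_image_of_injective _ (Prod.mk_right_injective α), ← Set.ncard_coe_finset]
  congr 1
  ext ⟨β, τ⟩
  simp only [Finset.coe_filter, Set.mem_toFinset, Set.mem_ofPred_eq, Set.mem_image, Prod.mk.injEq]
  constructor
  · rintro ⟨h, rfl⟩
    exact ⟨τ, h, rfl, rfl⟩
  · rintro ⟨σ, h, rfl, rfl⟩
    exact ⟨h, rfl⟩

/-! ### Assembling the generating functions -/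

theorem ncard_setA_succ (n : ℕ) : (setA (n + 1)).ncard = pathPerms 0 n := by
  rw [ncard_setA, sum_ballot]

theorem coeff_seriesA_succ (n : ℕ) : coeff (n + 1) seriesA = ((setA (n + 1)).ncard : ℚ) := by
  rw [seriesA_eq, coeff_succ_X_mul, pathPermsGF, coeff_mk, ncard_setA_succ]

theorem constantCoeff_seriesA : constantCoeff seriesA = 0 := by
  rw [seriesA_eq]
  simp

/-- The generating function of `(run n 0).ncard`. -/
noncomputable def runGF : PowerSeries ℚ := PowerSeries.mk fun n => ((run n 0).ncard : ℚ)

theorem constantCoeff_runGF : constantCoeff runGF = 1 := by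
  rw [← coeff_zero_eq_constantCoeff_apply, runGF, coeff_mk, ncard_run_zero_zero, Nat.cast_one]

theorem runGF_eq : runGF = 1 + seriesA * runGF := by
  ext n
  rcases n with _ | n
  · simp [constantCoeff_runGF, constantCoeff_seriesA]
  · rw [map_add, coeff_mul, Finset.Nat.sum_antidiagonal_eq_sum_range_succ_mk,
      Finset.sum_range_succ', coeff_zero_eq_constantCoeff_apply, constantCoeff_seriesA,
      runGF, coeff_mk, ncard_run_zero_succ]
    simp [coeff_one, coeff_seriesA_succ]

theorem seriesB_eq : seriesB = 2 * (runGF - 1) := by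
  ext n
  have h2 : (2 : PowerSeries ℚ) = C 2 := (map_ofNat C 2).symm
  rw [h2, coeff_C_mul]
  rcases n with _ | n
  · simp [seriesB, constantCoeff_runGF]
  · simp [seriesB, runGF, coeff_one, ncard_avStar (Nat.succ_pos n)]

end ThreeCyclePerm

theorem theorem132 :
    (∀ n : ℕ, 1 ≤ n →
      (ThreeCyclePerm.avStar n ThreeCyclePerm.pattern132).ncard =
        2 * ∑ x : Composition n, ∏ i : Fin x.length, (ThreeCyclePerm.setA (x.blocksFun i)).ncard) ∧
    ThreeCyclePerm.seriesB =
      2 * ThreeCyclePerm.seriesA * (1 - ThreeCyclePerm.seriesA)⁻¹ := by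
  refine ⟨fun n hn => ?_, ?_⟩
  · rw [ThreeCyclePerm.ncard_avStar hn, ThreeCyclePerm.ncard_run_zero_eq_sum]
  · have h := ThreeCyclePerm.runGF_eq
    have hinv : ThreeCyclePerm.runGF = (1 - ThreeCyclePerm.seriesA)⁻¹ := by
      rw [PowerSeries.eq_inv_iff_mul_eq_one (by simp [ThreeCyclePerm.constantCoeff_seriesA])]
      linear_combination h
    rw [← hinv, ThreeCyclePerm.seriesB_eq]
    linear_combination 2 * h
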